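/- **Setting.** Let $\Gamma$ be a finite connected simple graph with vertex set $X$, path-length distance $\partial$ and diameter $D\ge 3$. Assume that $\Gamma$ is distance-regular: for $0\le h,i,j\le D$ and all $y,z\in X$ with $\partial(y,z)=h$, the number of $w\in X$ with $\partial(y,w)=i$ and $\partial(z,w)=j$ depends only on $h,i,j$. For $0 \le i\le D$ let $A_i$ be the $i$-th distance matrix, with $(y,z)$-entry $1$ if $\partial(y,z)=i$ and $0$ otherwise. The adjacency matrix $A=A_1$ has exactly $D+1$ distinct eigenvalues $\theta_0,\dots,\theta_D$, all real, with $\theta_0$ the valency; let $E_i\in \mathrm{Mat}_X(\mathbb{R})$ be the primitive idempotent of $A$ for $\theta_i$, that is, the matrix acting as the identity on the $\theta_i$-eigenspace and as $0$ on the other eigenspaces. The Krein parameters $q^h_{i,j}$ are the real scalars defined by $E_i\circ E_j=|X|^{-1}\sum_{h=0}^D q^h_{i,j}E_h$, where $\circ$ is the entrywise product. Assume that $\Gamma$ is $Q$-polynomial: the ordering $E_0,\dots,E_D$ can be chosen so that $q^h_{i,j}=0$ whenever one of $h,i,j$ is greater than the sum of the other two, and $q^h_{i,j}\neq 0$ whenever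 one of $h,i,j$ equals the sum of the other two ($0\le h,i,j\le D$). Fix a vertex $x\in X$. For $0\le i\le D$ let $E_i^*$ be the diagonal matrix with $(y,y)$-entry $1$ if $\partial(x,y)=i$ and $0$ otherwise. For $\mathbb{F}\in\{\mathbb{R},\mathbb{C}\}$ let $T^{\mathbb{F}}$, the Terwilliger algebra of $\Gamma$ with respect to $x$, be the $\mathbb{F}$-subalgebra of $\mathrm{Mat}_X(\mathbb{F})$ generated by $A_0,\dots,A_D$ and $E_0^*,\dots,E_D^*$. **Theorem 1.5.** Suppose that $$T^{\mathbb{C}}\cong\bigoplus_{i=1}^{h}\mathrm{Mat}_{n_i}(\mathbb{C})\quad\text{as $\mathbb{C}$-algebras},\qquad T^{\mathbb{R}}\cong\bigoplus_{i=1}^{\ell}\mathrm{Mat}_{m_i}(\mathbb{D}_i)\quad\text{as $\mathbb{R}$-algebras},$$ where the $n_i$ and $m_i$ are positive integers and each $\mathbb{D}_i$ is (isomorphic as an $\mathbb{R}$-algebra to) $\mathbb{R}$, $\mathbb{C}$ or the quaternions $\mathbb{H}$. Then $\ell=h$; after a suitable reordering of the summands, $m_i=n_i$ for $1\le i\le \ell$;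 and $\mathbb{D}_i\cong\mathbb{R}$ as an $\mathbb{R}$-algebra for $1\le i\le\ell$. -/

import Mathlib

/-- A finite connected simple graph is *distance-regular* when, for all `h, i, j` and all vertices
`y, z` at distance `h`, the number of vertices `w` with `∂(y, w) = i` and `∂(z, w) = j`
depends only on `h, i, j`. -/
def IsDistanceRegular {X : Type*} [Fintype X] (G : SimpleGraph X) : Prop :=
  G.Connected ∧
    ∃ p : ℕ → ℕ → ℕ → ℕ, ∀ h i j : ℕ, ∀ y z : X, G.dist y z = h →
      (Finset.univ.filter fun w : X => G.dist y w = i ∧ G.dist z w = j).card = p h i j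

/-- The `i`-th distance matrix `A_i`. -/
noncomputable def distMatrix {X : Type*} (G : SimpleGraph X) (𝕜 : Type*) [Field 𝕜] (i : ℕ) : Matrix X X 𝕜 :=
  Matrix.of fun y z => if G.dist y z = i then 1 else 0

/-- The `i`-th dual primitive idempotent `E_i^* = E_i^*(x)`. -/
noncomputable def dualIdempotent {X : Type*} [DecidableEq X] (G : SimpleGraph X) (x : X)
    (𝕜 : Type*) [Field 𝕜] (i : ℕ) : Matrix X X 𝕜 :=
  Matrix.diagonal fun y => if G.dist x y = i then 1 else 0

/-- The Bose-Mesner algebra `M`, as the span of the distance matrices `A_0, …, A_D`. -/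
def boseMesner {X : Type*} (G : SimpleGraph X) (𝕜 : Type*) [Field 𝕜] :
    Submodule 𝕜 (Matrix X X 𝕜) :=
  Submodule.span 𝕜 {B | ∃ i ≤ G.diam, B = distMatrix G 𝕜 i}

/-- The dual Bose-Mesner algebra `M^* = M^*(x)`, as the span of `E_0^*, …, E_D^*`. -/
def dualBoseMesner {X : Type*} [DecidableEq X] (G : SimpleGraph X) (x : X)
    (𝕜 : Type*) [Field 𝕜] : Submodule 𝕜 (Matrix X X 𝕜) :=
  Submodule.span 𝕜 {B | ∃ i ≤ G.diam, B = dualIdempotent G x 𝕜 i}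

/-- The Terwilliger algebra `T = T(x)` over `𝕜`: the subalgebra of `Mat_X(𝕜)` generated by
`M` and `M^*(x)`. -/
def terwilligerAlgebra {X : Type*} [Fintype X] [DecidableEq X] (G : SimpleGraph X) (x : X)
    (𝕜 : Type*) [Field 𝕜] : Subalgebra 𝕜 (Matrix X X 𝕜) :=
  Algebra.adjoin 𝕜
    ((boseMesner G 𝕜 : Set (Matrix X X 𝕜)) ∪ (dualBoseMesner G x 𝕜 : Set (Matrix X X 𝕜)))

/-- `E_0, …, E_D` is an ordering of the primitive idempotents of the adjacency matrix `A = A_1`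
(a real symmetric, hence diagonalizable, matrix): the distinct eigenvalues of `A` are
`θ_0, …, θ_D`, the eigenvalue `θ_0` is the valency, and `E_i` acts as the identity on the
eigenspace of `θ_i` and as zero on the other eigenspaces. -/
def IsPrimitiveIdempotentOrdering {X : Type*} [Fintype X] [DecidableEq X] (G : SimpleGraph X)
    (E : Fin (G.diam + 1) → Matrix X X ℝ) : Prop :=
  ∃ θ : Fin (G.diam + 1) → ℝ,
    Function.Injective θ ∧
    (∀ t : ℝ, Module.End.HasEigenvalue (Matrix.toLin' (distMatrix G ℝ 1)) t ↔ ∃ i, θ i = t) ∧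
    (∀ y : X, ((G.neighborSet y).ncard : ℝ) = θ 0) ∧
    (∀ i, ∀ v : X → ℝ, (distMatrix G ℝ 1).mulVec v = θ i • v → (E i).mulVec v = v) ∧
    (∀ i j, i ≠ j → ∀ v : X → ℝ,
      (distMatrix G ℝ 1).mulVec v = θ j • v → (E i).mulVec v = 0)

/-- `q h i j = q^h_{i,j}` are the Krein parameters with respect to the ordering `E`:
`E_i ∘ E_j = |X|⁻¹ ∑_h q^h_{i,j} E_h`, where `∘` is the entrywise product. They are unique,
since the primitive idempotents are linearly independent. -/
def IsKreinParameters {X : Type*} [Fintype X] (G : SimpleGraph X)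
    (E : Fin (G.diam + 1) → Matrix X X ℝ)
    (q : Fin (G.diam + 1) → Fin (G.diam + 1) → Fin (G.diam + 1) → ℝ) : Prop :=
  ∀ i j, Matrix.hadamard (E i) (E j) = (Fintype.card X : ℝ)⁻¹ • ∑ h, q h i j • E h

/-- The ordering `E_0, …, E_D` is `Q`-polynomial: `q^h_{i,j}` vanishes if one of `h, i, j` is
greater than the sum of the other two, and is nonzero if one equals the sum of the other two. -/
def IsQPolynomialOrdering {X : Type*} [Fintype X] [DecidableEq X] (G : SimpleGraph X)
    (E : Fin (G.diam + 1) → Matrix X X ℝ) : Prop :=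
  IsPrimitiveIdempotentOrdering G E ∧
    ∃ q : Fin (G.diam + 1) → Fin (G.diam + 1) → Fin (G.diam + 1) → ℝ,
      IsKreinParameters G E q ∧
      ∀ h i j : Fin (G.diam + 1),
        ((i : ℕ) + j < h ∨ (h : ℕ) + j < i ∨ (h : ℕ) + i < j → q h i j = 0) ∧
        ((h : ℕ) = i + j ∨ (i : ℕ) = h + j ∨ (j : ℕ) = h + i → q h i j ≠ 0)

/-- The graph is `Q`-polynomial: its primitive idempotents have a `Q`-polynomial ordering. -/
def IsQPolynomial {X : Type*} [Fintype X] [DecidableEq X] (G : SimpleGraph X) : Prop :=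
  ∃ E : Fin (G.diam + 1) → Matrix X X ℝ, IsQPolynomialOrdering G E

/-! The real algebra `T` is semisimple and closed under transposition; what has to be shown is that
each of its simple summands is split over `ℝ`. Let `c` be the central idempotent of a summand
`Mat_m(𝔻)`, and let `r` be its endpoint, the least index with `c E_r^* ≠ 0`. The key fact
(`transpose_corner_eq`) is that the corner `c E_r^* T E_r^*` consists of symmetric matrices. This
corner contains a copy of `𝔻` (`Matrix.exists_corner_embedding`), so an element of `𝔻` with square
`-1` would give a symmetric real matrix `a` and a nonzero symmetric idempotent `b` with `a² = -b`;
the traces of `a²` and `b` are both nonnegative, which forces `b = 0`. This excludes `ℂ` and `ℍ`.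

The symmetry comes from a tridiagonal relation. The adjacency matrix is tridiagonal with respect to
the `E_i^*`, and the `Q`-polynomial property provides a dual adjacency matrix that is tridiagonal
with respect to the `E_i`. Applied to powers of the two matrices, this gives many linear relations
of Vandermonde type between the words `E_i E_l^* E_k` and `E_i^* E_l E_k^*`. They imply that the
elements `c E_r^* E_i E_r^*` commute (`commute_corner`), and that high middle indices can be
eliminated from longer words, so that these elements control the whole corner
(`exists_submodule_mul_closed`). Transposition fixes them and reverses products, hence fixes all
that they generate.

Finally `T^ℂ` is the complexification of `T^ℝ`, so it is a product of the `Mat_{m_i}(ℂ)`, and the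
block sizes of such a product are unique. -/

/-! ### Vanishing of arrays by Vandermonde arguments -/

open Finset in
-- Vandermonde: vanishing moments annihilate every polynomial of degree below `p`, in particular the
-- one vanishing at all nodes of `S` except `θ i`.
theorem eq_zero_of_moments_eq_zero {ι K M : Type*} [Field K] [AddCommGroup M] [Module K M]
    [Fintype ι] {θ : ι → K} (hθ : Function.Injective θ) {g : ι → M} {p : ℕ}
    (hg : ∀ s < p, ∑ i, θ i ^ s • g i = 0) (S : Finset ι) (hS : S.card ≤ p)
    (h0 : ∀ i ∉ S, g i = 0) (i : ι) : g i = 0 := by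
  classical
  by_cases hi : i ∈ S
  swap
  · exact h0 i hi
  have key : ∀ P : Polynomial K, P.natDegree < p → ∑ i, P.eval (θ i) • g i = 0 := by
    intro P hP
    simp_rw [Polynomial.eval_eq_sum_range' hP, Finset.sum_smul]
    rw [Finset.sum_comm]
    refine Finset.sum_eq_zero fun s hs => ?_
    simp_rw [mul_smul]
    rw [← Finset.smul_sum, hg s (Finset.mem_range.1 hs), smul_zero]
  have hP := key (∏ j ∈ S.erase i, (Polynomial.X - Polynomial.C (θ j))) (by
    rw [Polynomial.natDegree_prod_of_monic _ _ fun j _ => Polynomial.monic_X_sub_C _]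
    simp only [Polynomial.natDegree_X_sub_C, sum_const, smul_eq_mul, mul_one]
    exact lt_of_lt_of_le (Finset.card_erase_lt_of_mem hi) hS)
  rw [Finset.sum_eq_single i] at hP
  · rcases smul_eq_zero.1 hP with h | h
    · rw [Polynomial.eval_prod, Finset.prod_eq_zero_iff] at h
      obtain ⟨j, hj, hj'⟩ := h
      simp only [Polynomial.eval_sub, Polynomial.eval_X, Polynomial.eval_C, sub_eq_zero] at hj'
      exact absurd (hθ hj').symm (Finset.ne_of_mem_erase hj)
    · exact h
  · intro j _ hji
    by_cases hj : j ∈ S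
    · rw [Polynomial.eval_prod, Finset.prod_eq_zero (Finset.mem_erase.2 ⟨hji, hj⟩) (by simp),
        zero_smul]
    · rw [h0 j hj, smul_zero]
  · simp

theorem Fin.card_filter_Ico_le {n : ℕ} (a b : ℕ) :
    (Finset.univ.filter fun i : Fin n => a ≤ i.1 ∧ i.1 < b).card ≤ b - a := by
  rw [← Nat.card_Ico]
  exact Finset.card_le_card_of_injOn (fun i => i.1) (fun i hi => by simpa using hi)
    (fun i _ j _ h => Fin.ext h)

/-- A three-index array with the sparsity coming from two mutually tridiagonal families of
idempotents vanishes as soon as it vanishes at all middle indices below `J`. -/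
theorem array_eq_zero_of_tridiagonal {K M : Type*} [Field K] [AddCommGroup M] [Module K M] {n : ℕ}
    {θ θs : Fin n → K} (hθ : Function.Injective θ) (hθs : Function.Injective θs)
    {f : Fin n → Fin n → Fin n → M} {j m J : ℕ} (hj : j < J) (hm : m ≤ J)
    (ha : ∀ (i k : Fin n) (s : ℕ), s + i < k ∨ s + k < i → ∑ l, θs l ^ s • f i l k = 0)
    (hb : ∀ (l k : Fin n) (s : ℕ), s + j < l → ∑ i, θ i ^ s • f i l k = 0)
    (hc : ∀ (i l : Fin n) (s : ℕ), s + m < l → ∑ k, θ k ^ s • f i l k = 0)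
    (hd : ∀ i l k : Fin n, l.1 < J → f i l k = 0) (i l k : Fin n) : f i l k = 0 := by
  -- Downward induction on the middle index: all slices above `l` are already zero.
  have main : ∀ N : ℕ, ∀ l : Fin n, n - l.1 ≤ N → ∀ i k, f i l k = 0 := by
    intro N
    induction N with
    | zero => intro l hl; omega
    | succ N ih =>
      intro l hl
      by_cases hlJ : l.1 < J
      · exact fun i k => hd i l k hlJ
      -- Only the middle indices `J, …, l` can contribute, which are `l - J + 1` unknowns; this far
      -- from the diagonal the same number of moments vanish.
      have far : ∀ i k : Fin n, (l.1 - J + 1) + i.1 ≤ k.1 ∨ (l.1 - J + 1) + k.1 ≤ i.1 →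
          f i l k = 0 := by
        intro i k hik
        refine eq_zero_of_moments_eq_zero (g := fun l => f i l k) hθs
          (p := l.1 - J + 1) (fun s hs => ha i k s (by omega))
          (Finset.univ.filter fun l' : Fin n => J ≤ l'.1 ∧ l'.1 < l.1 + 1)
          ((Fin.card_filter_Ico_le _ _).trans (by omega)) ?_ l
        intro l' hl'
        by_cases h : l'.1 < J
        · exact hd i l' k h
        · exact ih l' (by simp at hl'; omega) i k
      -- The slice `l` is now a band matrix, and column `t` and row `t` are cleared in turn. In the
      -- column, `l - J + 1` unknowns remain, at most `l - j` because `j < J`. In the row the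
      -- diagonal entry is already known, so `l - J` remain and `m ≤ J` suffices.
      have rad : ∀ N : ℕ, ∀ t : Fin n, t.1 < N → (∀ i, f i l t = 0) ∧ ∀ k, f t l k = 0 := by
        intro N
        induction N with
        | zero => intro t ht; omega
        | succ N ihN =>
          intro t ht
          have right : ∀ i, f i l t = 0 := by
            refine eq_zero_of_moments_eq_zero (g := fun i => f i l t) hθ (p := l.1 - j)
              (fun s hs => hb l t s (by omega))
              (Finset.univ.filter fun i : Fin n => t.1 ≤ i.1 ∧ i.1 < t.1 + (l.1 - J + 1))
              ((Fin.card_filter_Ico_le _ _).trans (by omega)) ?_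
            intro i hi
            by_cases h : i.1 < t.1
            · exact (ihN i (by omega)).2 t
            · exact far i t (by simp at hi; omega)
          refine ⟨right, ?_⟩
          refine eq_zero_of_moments_eq_zero (g := fun k => f t l k) hθ (p := l.1 - m)
            (fun s hs => hc t l s (by omega))
            (Finset.univ.filter fun k : Fin n => t.1 + 1 ≤ k.1 ∧ k.1 < t.1 + (l.1 - J + 1))
            ((Fin.card_filter_Ico_le _ _).trans (by omega)) ?_
          intro k hk
          by_cases h : k.1 < t.1
          · exact (ihN k (by omega)).1 t
          by_cases h' : k = t
          · rw [h']; exact right t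
          · have : k.1 ≠ t.1 := fun h => h' (Fin.ext h)
            exact far t k (by simp at hk; omega)
      exact fun i k => (rad (i.1 + 1) i (by omega)).2 k
  exact main n l (by omega) i k

/-- An alternating three-index array with the sparsity coming from two mutually tridiagonal
families of idempotents vanishes. -/
theorem alternating_array_eq_zero {K M : Type*} [Field K] [AddCommGroup M] [Module K M] {n : ℕ}
    {θ θs : Fin n → K} (hθ : Function.Injective θ) (hθs : Function.Injective θs)
    {f : Fin n → Fin n → Fin n → M} {r : ℕ}
    (hdiag : ∀ i l, f i l i = 0) (halt : ∀ i l k, f i l k = - f k l i)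
    (ha : ∀ (i k : Fin n) (s : ℕ), s + i < k ∨ s + k < i → ∑ l, θs l ^ s • f i l k = 0)
    (hb : ∀ (l k : Fin n) (s : ℕ), s + r < l → ∑ i, θ i ^ s • f i l k = 0)
    (hd : ∀ i l k : Fin n, l.1 < r → f i l k = 0) (i l k : Fin n) : f i l k = 0 := by
  classical
  -- Weighting by `P t` kills the middle indices `r, …, r + t - 1`, while its degree `t` keeps the
  -- sum `b t` inside the band `|i - k| ≤ t`.
  let P : ℕ → Polynomial K := fun t =>
    ∏ u ∈ Finset.univ.filter (fun u : Fin n => r ≤ u.1 ∧ u.1 < r + t),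
      (Polynomial.X - Polynomial.C (θs u))
  have hPdeg : ∀ t, (P t).natDegree ≤ t := by
    intro t
    rw [Polynomial.natDegree_prod_of_monic _ _ fun j _ => Polynomial.monic_X_sub_C _]
    simp only [Polynomial.natDegree_X_sub_C, Finset.sum_const, smul_eq_mul, mul_one]
    exact (Fin.card_filter_Ico_le _ _).trans (by omega)
  have hPzero : ∀ t, ∀ l : Fin n, r ≤ l.1 → l.1 < r + t → (P t).eval (θs l) = 0 := by
    intro t l h1 h2
    rw [Polynomial.eval_prod, Finset.prod_eq_zero (i := l) (by simp [h1, h2]) (by simp)]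
  have hPne : ∀ t, ∀ l : Fin n, r + t ≤ l.1 → (P t).eval (θs l) ≠ 0 := by
    intro t l h1
    rw [Polynomial.eval_prod, Finset.prod_ne_zero_iff]
    intro u hu
    simp only [Polynomial.eval_sub, Polynomial.eval_X, Polynomial.eval_C, ne_eq, sub_eq_zero]
    intro h
    have := hθs h
    simp at hu
    omega
  let b : ℕ → Fin n → Fin n → M := fun t i k => ∑ l, (P t).eval (θs l) • f i l k
  have bfar : ∀ (t : ℕ) (i k : Fin n), t + i.1 < k.1 ∨ t + k.1 < i.1 → b t i k = 0 := by
    intro t i k hik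
    simp only [b]
    simp_rw [Polynomial.eval_eq_sum_range' (Nat.lt_succ_of_le (hPdeg t)), Finset.sum_smul]
    rw [Finset.sum_comm]
    refine Finset.sum_eq_zero fun s hs => ?_
    simp_rw [mul_smul]
    rw [← Finset.smul_sum, ha i k s (by simp at hs; omega), smul_zero]
  have balt : ∀ t i k, b t i k = - b t k i := by
    intro t i k
    simp only [b, ← Finset.sum_neg_distrib]
    exact Finset.sum_congr rfl fun l _ => by rw [halt i l k, smul_neg]
  have bmom : ∀ t k, ∀ s < t, ∑ i, θ i ^ s • b t i k = 0 := by
    intro t k s hs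
    simp only [b, Finset.smul_sum]
    rw [Finset.sum_comm]
    refine Finset.sum_eq_zero fun l _ => ?_
    by_cases h1 : l.1 < r
    · exact Finset.sum_eq_zero fun i _ => by rw [hd i l k h1, smul_zero, smul_zero]
    by_cases h2 : l.1 < r + t
    · exact Finset.sum_eq_zero fun i _ => by
        rw [hPzero t l (by omega) h2, zero_smul, smul_zero]
    simp_rw [smul_comm (θ _ ^ s)]
    rw [← Finset.smul_sum, hb l k s (by omega), smul_zero]
  -- Antisymmetry disposes of `i < k`, leaving the `t` unknowns `k < i ≤ k + t` against `t`
  -- vanishing moments.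
  have bzero : ∀ t, ∀ N : ℕ, ∀ k : Fin n, k.1 < N → ∀ i, b t i k = 0 := by
    intro t N
    induction N with
    | zero => intro k hk; omega
    | succ N ih =>
      intro k hk
      refine eq_zero_of_moments_eq_zero (g := fun i => b t i k) hθ (bmom t k)
        (Finset.univ.filter fun i : Fin n => k.1 + 1 ≤ i.1 ∧ i.1 < k.1 + 1 + t)
        ((Fin.card_filter_Ico_le _ _).trans (by omega)) ?_
      intro i hi
      by_cases h : i.1 < k.1
      · rw [balt, ih i (by omega), neg_zero]
      by_cases h' : i = k
      · subst h'
        exact Finset.sum_eq_zero fun l _ => by rw [hdiag, smul_zero]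
      · have : i.1 ≠ k.1 := fun h => h' (Fin.ext h)
        exact bfar t i k (by simp at hi; omega)
  -- The system `b t = 0` is triangular: with `t = l - r` the indices below `l` are killed by `P t`,
  -- those above `l` by induction.
  have main : ∀ N : ℕ, ∀ l : Fin n, n - l.1 ≤ N → f i l k = 0 := by
    intro N
    induction N with
    | zero => intro l hl; omega
    | succ N ih =>
      intro l hl
      by_cases hlr : l.1 < r
      · exact hd i l k hlr
      have h := bzero (l.1 - r) (k.1 + 1) k (by omega) i
      simp only [b] at h
      rw [Finset.sum_eq_single l] at h
      · exact (smul_eq_zero.1 h).resolve_left (hPne _ l (by omega))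
      · intro l' _ hl'
        have hne : l'.1 ≠ l.1 := fun h => hl' (Fin.ext h)
        by_cases h1 : l'.1 < r
        · rw [hd i l' k h1, smul_zero]
        by_cases h2 : l'.1 < l.1
        · rw [hPzero _ l' (by omega) (by omega), zero_smul]
        · rw [ih l' (by omega), smul_zero]
      · simp
  exact main n l (by omega)

/-! ### Tridiagonal systems of idempotents and their word relations -/

/-- Two families of pairwise orthogonal idempotents with sum `1`, together with eigenvalues, such
that each of the resulting elements `∑ θ i • E i` and `∑ θs i • Es i` is tridiagonal with respect
to the other family. -/
structure TridiagonalIdempotents (K 𝒜 : Type*) [Field K] [Ring 𝒜] [Algebra K 𝒜] (n : ℕ) where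
  E : Fin n → 𝒜
  Es : Fin n → 𝒜
  θ : Fin n → K
  θs : Fin n → K
  θ_injective : Function.Injective θ
  θs_injective : Function.Injective θs
  mul_E : ∀ i j, E i * E j = if i = j then E i else 0
  mul_Es : ∀ i j, Es i * Es j = if i = j then Es i else 0
  sum_E : ∑ i, E i = 1
  sum_Es : ∑ i, Es i = 1
  E_tridiag : ∀ i k : Fin n, 1 + i.1 < k.1 ∨ 1 + k.1 < i.1 → E i * (∑ l, θs l • Es l) * E k = 0
  Es_tridiag : ∀ i k : Fin n, 1 + i.1 < k.1 ∨ 1 + k.1 < i.1 → Es i * (∑ l, θ l • E l) * Es k = 0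

theorem sum_smul_pow_of_orthogonal {K 𝒜 ι : Type*} [Field K] [Ring 𝒜] [Algebra K 𝒜] [Fintype ι]
    [DecidableEq ι] {e : ι → 𝒜} {θ : ι → K} (he : ∀ i j, e i * e j = if i = j then e i else 0)
    (h1 : ∑ i, e i = 1) (s : ℕ) : (∑ i, θ i • e i) ^ s = ∑ i, θ i ^ s • e i := by
  induction s with
  | zero => simp [h1]
  | succ s ih =>
    rw [pow_succ, ih, Finset.sum_mul]
    refine Finset.sum_congr rfl fun i _ => ?_
    rw [Finset.mul_sum, Finset.sum_eq_single i]
    · rw [smul_mul_smul_comm, he, if_pos rfl, pow_succ]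
    · intro j _ hj
      rw [smul_mul_smul_comm, he, if_neg hj.symm, smul_zero]
    · simp

/-- The `s`-th power of a tridiagonal element has bandwidth `s`. -/
theorem mul_pow_mul_eq_zero_of_tridiagonal {𝒜 : Type*} [Ring 𝒜] {n : ℕ} {e : Fin n → 𝒜} {a : 𝒜}
    (he : ∀ i j, e i * e j = if i = j then e i else 0) (h1 : ∑ i, e i = 1)
    (ha : ∀ i k : Fin n, 1 + i.1 < k.1 ∨ 1 + k.1 < i.1 → e i * a * e k = 0) (s : ℕ)
    (i k : Fin n) (hik : s + i.1 < k.1 ∨ s + k.1 < i.1) : e i * a ^ s * e k = 0 := by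
  induction s generalizing k with
  | zero =>
    rw [pow_zero, mul_one, he, if_neg]
    rintro rfl
    omega
  | succ s ih =>
    have : e i * a ^ (s + 1) * e k = ∑ l, (e i * a ^ s * e l) * (e l * a * e k) := by
      calc e i * a ^ (s + 1) * e k = e i * a ^ s * (∑ l, e l) * a * e k := by
            rw [h1, pow_succ]; noncomm_ring
        _ = _ := by
            simp only [Finset.mul_sum, Finset.sum_mul]
            refine Finset.sum_congr rfl fun l _ => ?_
            have : e l = e l * e l := by rw [he, if_pos rfl]
            conv_lhs => rw [this]
            noncomm_ring
    rw [this]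
    refine Finset.sum_eq_zero fun l _ => ?_
    by_cases h : s + i.1 < l.1 ∨ s + l.1 < i.1
    · rw [ih l h, zero_mul]
    · rw [ha l k (by omega), mul_zero]

namespace TridiagonalIdempotents

variable {K 𝒜 : Type*} [Field K] [Ring 𝒜] [Algebra K 𝒜] {n : ℕ}
  (Φ : TridiagonalIdempotents K 𝒜 n)

/-- Expanding a power of `∑ θs l • Es l` spectrally turns the band condition into moment conditions
for the array lemmas. -/
theorem sum_E_mul_Es_mul_E (i k : Fin n) (s : ℕ) (h : s + i.1 < k.1 ∨ s + k.1 < i.1) :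
    ∑ l, Φ.θs l ^ s • (Φ.E i * Φ.Es l * Φ.E k) = 0 := by
  have := mul_pow_mul_eq_zero_of_tridiagonal Φ.mul_E Φ.sum_E Φ.E_tridiag s i k h
  rw [sum_smul_pow_of_orthogonal Φ.mul_Es Φ.sum_Es, Finset.mul_sum, Finset.sum_mul] at this
  simpa using this

theorem sum_Es_mul_E_mul_Es (i k : Fin n) (s : ℕ) (h : s + i.1 < k.1 ∨ s + k.1 < i.1) :
    ∑ l, Φ.θ l ^ s • (Φ.Es i * Φ.E l * Φ.Es k) = 0 := by
  have := mul_pow_mul_eq_zero_of_tridiagonal Φ.mul_Es Φ.sum_Es Φ.Es_tridiag s i k h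
  rw [sum_smul_pow_of_orthogonal Φ.mul_E Φ.sum_E, Finset.mul_sum, Finset.sum_mul] at this
  simpa using this

/-- If `N` is stable under right multiplication by `E i * Es l` for `l < J`, then middle indices
`l ≥ J` can be eliminated from the words `y * E i * Es l * E k * Es m` with `y ∈ N`, `m ≤ J`. -/
theorem mul_mem_of_elimination (N : Submodule K 𝒜) (J : ℕ)
    (hN : ∀ y ∈ N, ∀ i l : Fin n, l.1 < J → y * Φ.E i * Φ.Es l ∈ N)
    (Q : Submodule K 𝒜) (m : Fin n) (hm : m.1 ≤ J)
    (hQ : ∀ y ∈ N, ∀ k, y * Φ.E k * Φ.Es m ∈ Q)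
    (j : Fin n) (hj : j.1 < J) (y : 𝒜) (hy : y ∈ N) (hyj : y * Φ.Es j = y) (i l k : Fin n) :
    y * Φ.E i * Φ.Es l * Φ.E k * Φ.Es m ∈ Q := by
  -- Modulo `Q` the words with middle index below `J` vanish. The moments in `l` come from `E i … E
  -- k`, those in `i` from `Es j … Es l` since `y = y * Es j`, and those in `k` from `Es l … Es m`.
  rw [← Submodule.Quotient.mk_eq_zero, ← Submodule.mkQ_apply]
  refine array_eq_zero_of_tridiagonal (M := 𝒜 ⧸ Q) Φ.θ_injective Φ.θs_injective
    (f := fun i l k => Q.mkQ (y * Φ.E i * Φ.Es l * Φ.E k * Φ.Es m)) hj hm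
    ?_ ?_ ?_ ?_ i l k
  · intro i k s h
    simp only [← map_smul, ← map_sum]
    refine (congrArg Q.mkQ ?_).trans (map_zero _)
    calc _ = y * (∑ l, Φ.θs l ^ s • (Φ.E i * Φ.Es l * Φ.E k)) * Φ.Es m := by
          simp only [Finset.mul_sum, Finset.sum_mul, mul_smul_comm, smul_mul_assoc, mul_assoc]
      _ = 0 := by rw [Φ.sum_E_mul_Es_mul_E i k s h, mul_zero, zero_mul]
  · intro l k s h
    simp only [← map_smul, ← map_sum]
    refine (congrArg Q.mkQ ?_).trans (map_zero _)
    calc _ = y * (∑ i, Φ.θ i ^ s • (Φ.Es j * Φ.E i * Φ.Es l)) * Φ.E k * Φ.Es m := by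
          conv_lhs => rw [← hyj]
          simp only [Finset.mul_sum, Finset.sum_mul, mul_smul_comm, smul_mul_assoc, mul_assoc]
      _ = 0 := by rw [Φ.sum_Es_mul_E_mul_Es j l s (Or.inl h)]; simp
  · intro i l s h
    simp only [← map_smul, ← map_sum]
    refine (congrArg Q.mkQ ?_).trans (map_zero _)
    calc _ = y * Φ.E i * (∑ k, Φ.θ k ^ s • (Φ.Es l * Φ.E k * Φ.Es m)) := by
          simp only [Finset.mul_sum, mul_smul_comm, mul_assoc]
      _ = 0 := by rw [Φ.sum_Es_mul_E_mul_Es l m s (Or.inr h), mul_zero]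
  · intro i l k h
    rw [Submodule.mkQ_apply, Submodule.Quotient.mk_eq_zero]
    exact hQ _ (hN y hy i l h) k

/-- The elements `Es r * E i * Es r` commute on the part of the algebra with endpoint `r`. -/
theorem commute_corner {c : 𝒜} (hcE : ∀ i, Commute c (Φ.E i)) (hcEs : ∀ i, Commute c (Φ.Es i))
    {r : Fin n} (hr : ∀ l, l.1 < r.1 → c * Φ.Es l = 0) (i l k : Fin n) :
    c * Φ.Es r * Φ.E i * Φ.Es l * Φ.E k * Φ.Es r =
      c * Φ.Es r * Φ.E k * Φ.Es l * Φ.E i * Φ.Es r := by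
  rw [← sub_eq_zero]
  refine alternating_array_eq_zero Φ.θ_injective Φ.θs_injective (r := r.1)
    (f := fun i l k => c * Φ.Es r * Φ.E i * Φ.Es l * Φ.E k * Φ.Es r -
      c * Φ.Es r * Φ.E k * Φ.Es l * Φ.E i * Φ.Es r)
    (fun i l => sub_self _) (fun i l k => (neg_sub _ _).symm) ?_ ?_ ?_ i l k
  · intro i k s h
    calc _ = c * Φ.Es r * (∑ l, Φ.θs l ^ s • (Φ.E i * Φ.Es l * Φ.E k)) * Φ.Es r
          - c * Φ.Es r * (∑ l, Φ.θs l ^ s • (Φ.E k * Φ.Es l * Φ.E i)) * Φ.Es r := by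
          simp only [Finset.mul_sum, Finset.sum_mul, mul_smul_comm, smul_mul_assoc, mul_assoc,
            smul_sub, Finset.sum_sub_distrib]
      _ = 0 := by
          rw [Φ.sum_E_mul_Es_mul_E i k s h, Φ.sum_E_mul_Es_mul_E k i s h.symm]
          simp
  · intro l k s h
    calc _ = c * (∑ i, Φ.θ i ^ s • (Φ.Es r * Φ.E i * Φ.Es l)) * Φ.E k * Φ.Es r
          - c * Φ.Es r * Φ.E k * (∑ i, Φ.θ i ^ s • (Φ.Es l * Φ.E i * Φ.Es r)) := by
          simp only [Finset.mul_sum, Finset.sum_mul, mul_smul_comm, smul_mul_assoc, mul_assoc,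
            smul_sub, Finset.sum_sub_distrib]
      _ = 0 := by
          rw [Φ.sum_Es_mul_E_mul_Es r l s (Or.inl h), Φ.sum_Es_mul_E_mul_Es l r s (Or.inr h)]
          simp
  · intro i l k h
    -- Centrality moves `c` next to `Es l`, where minimality of `r` applies.
    have key : ∀ i k, c * Φ.Es r * Φ.E i * Φ.Es l * Φ.E k * Φ.Es r = 0 := by
      intro i k
      calc _ = Φ.Es r * Φ.E i * (c * Φ.Es l) * Φ.E k * Φ.Es r := by
            rw [(hcEs r).eq, mul_assoc (Φ.Es r) c, (hcE i).eq]
            simp only [mul_assoc]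
        _ = 0 := by rw [hr l h]; simp
    rw [key, key, sub_zero]

end TridiagonalIdempotents

/-! ### The corner at the endpoint is fixed by the antiautomorphism -/

namespace TridiagonalIdempotents

section Corner

variable {K 𝒜 : Type*} [Field K] [Ring 𝒜] [Algebra K 𝒜] {n : ℕ}
  (Φ : TridiagonalIdempotents K 𝒜 n)

/-- The part of the centralizer of the elements `c * Es r * E i * Es r` in the corner at `c * Es r`
that is fixed by `σ`. -/
def cornerFixed (c : 𝒜) (r : Fin n) (σ : 𝒜 →ₗ[K] 𝒜) : Submodule K 𝒜 where
  carrier := {y | y * c = y ∧ y * Φ.Es r = y ∧ σ y = y ∧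
    ∀ i, Commute y (c * Φ.Es r * Φ.E i * Φ.Es r)}
  zero_mem' := by simp
  add_mem' := by
    rintro a b ⟨h1, h2, h3, h4⟩ ⟨k1, k2, k3, k4⟩
    exact ⟨by rw [add_mul, h1, k1], by rw [add_mul, h2, k2], by rw [map_add, h3, k3],
      fun i => (h4 i).add_left (k4 i)⟩
  smul_mem' := by
    rintro t a ⟨h1, h2, h3, h4⟩
    exact ⟨by rw [smul_mul_assoc, h1], by rw [smul_mul_assoc, h2], by rw [map_smul, h3],
      fun i => (h4 i).smul_left t⟩

variable {Φ}

/-- Words starting in the corner at `c * Es r` and ending in `Es r` are generated by the elements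
`c * Es r * E i * Es r`, so they inherit being fixed by an antiautomorphism. -/
theorem exists_submodule_mul_closed {c : 𝒜} {r : Fin n} {σ : 𝒜 →ₗ[K] 𝒜}
    (hσ : ∀ a b, σ (a * b) = σ b * σ a) (hσE : ∀ i, σ (Φ.E i) = Φ.E i)
    (hσEs : ∀ i, σ (Φ.Es i) = Φ.Es i) (hσc : σ c = c)
    (hc : c * c = c) (hcE : ∀ i, Commute c (Φ.E i)) (hcEs : ∀ i, Commute c (Φ.Es i))
    (hr : ∀ l, l.1 < r.1 → c * Φ.Es l = 0) (d : ℕ) :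
    ∃ N : Submodule K 𝒜, c * Φ.Es r ∈ N ∧
      (∀ y ∈ N, ∀ i l : Fin n, l.1 < r.1 + 1 + d → y * Φ.E i * Φ.Es l ∈ N) ∧
      (∀ y ∈ N, ∀ l : Fin n, r.1 + 1 + d ≤ l.1 → y * Φ.Es l = 0) ∧
      ∀ y ∈ N, y * Φ.Es r ∈ Φ.cornerFixed c r σ := by
  have hEsr : Φ.Es r * Φ.Es r = Φ.Es r := by rw [Φ.mul_Es, if_pos rfl]
  induction d with
  | zero =>
    -- Only `l ≤ r` is allowed here, and `l < r` gives zero, so `cornerFixed` need only be closed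
    -- under right multiplication by the `g i`.
    let g : Fin n → 𝒜 := fun i => c * Φ.Es r * Φ.E i * Φ.Es r
    have hg : ∀ i, c * Φ.Es r * Φ.E i * Φ.Es r = g i := fun _ => rfl
    have gσ : ∀ i, σ (g i) = g i := by
      intro i
      simp only [g, hσ, hσE, hσEs, hσc]
      have h1 : Commute c (Φ.Es r * (Φ.E i * (Φ.Es r))) :=
        (hcEs r).mul_right ((hcE i).mul_right (hcEs r))
      rw [(hcEs r).symm.eq, mul_assoc c, mul_assoc c, mul_assoc, h1.eq]
      simp only [mul_assoc]
      rw [(hcEs r).eq]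
    have gcomm : ∀ i k, Commute (g i) (g k) := by
      have key : ∀ i k, g i * g k = c * Φ.Es r * Φ.E i * Φ.Es r * Φ.E k * Φ.Es r := by
        intro i k
        have h1 : Commute c (Φ.E i * Φ.Es r) := (hcE i).mul_right (hcEs r)
        calc g i * g k = c * Φ.Es r * (Φ.E i * Φ.Es r * c) * Φ.Es r * Φ.E k * Φ.Es r := by
              simp only [g, mul_assoc]
          _ = c * (Φ.Es r * c) * Φ.E i * (Φ.Es r * Φ.Es r) * Φ.E k * Φ.Es r := by
              rw [h1.symm.eq]; simp only [mul_assoc]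
          _ = (c * c) * Φ.Es r * Φ.E i * (Φ.Es r * Φ.Es r) * Φ.E k * Φ.Es r := by
              rw [(hcEs r).symm.eq]; simp only [mul_assoc]
          _ = _ := by rw [hc, hEsr]
      intro i k
      rw [Commute, SemiconjBy, key, key, Φ.commute_corner hcE hcEs hr]
    refine ⟨Φ.cornerFixed c r σ, ⟨?_, ?_, ?_, ?_⟩, ?_, ?_, ?_⟩
    · rw [mul_assoc, (hcEs r).symm.eq, ← mul_assoc, hc]
    · rw [mul_assoc, hEsr]
    · rw [hσ, hσEs, hσc, (hcEs r).eq]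
    · intro i
      refine Commute.mul_left ?_ ?_
      · exact (((Commute.refl c).mul_right (hcEs r)).mul_right (hcE i)).mul_right (hcEs r)
      · rw [Commute, SemiconjBy]
        calc _ = (Φ.Es r * c) * Φ.Es r * Φ.E i * Φ.Es r := by simp only [mul_assoc]
          _ = c * (Φ.Es r * Φ.Es r) * Φ.E i * Φ.Es r := by
            rw [(hcEs r).symm.eq]; simp only [mul_assoc]
          _ = c * Φ.Es r * Φ.E i * (Φ.Es r * Φ.Es r) := by rw [hEsr]
          _ = _ := by simp only [mul_assoc]
    · rintro y ⟨h1, h2, h3, h4⟩ i l hl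
      by_cases hlr : l = r
      · subst hlr
        have : y * Φ.E i * Φ.Es l = y * g i := by
          calc _ = y * c * Φ.Es l * Φ.E i * Φ.Es l := by rw [h1, h2]
            _ = _ := by simp only [g, mul_assoc]
        rw [this]
        refine ⟨?_, ?_, ?_, fun k => (h4 k).mul_left (gcomm i k)⟩
        · have h5 : Commute c (g i) :=
            (((Commute.refl c).mul_right (hcEs l)).mul_right (hcE i)).mul_right (hcEs l)
          rw [mul_assoc, h5.symm.eq, ← mul_assoc, h1]
        · simp only [g, mul_assoc, hEsr]
        -- `σ (y * g i) = g i * y`, which is why commuting with all `g i` is built into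
        -- `cornerFixed`.
        · rw [hσ, gσ, h3, ← hg i, (h4 i).eq]
      · have hlt : l.1 < r.1 := by
          have : l.1 ≠ r.1 := fun h => hlr (Fin.ext h)
          omega
        have : y * Φ.E i * Φ.Es l = 0 := by
          calc _ = y * (c * Φ.E i) * Φ.Es l := by rw [← mul_assoc y c, h1]
            _ = y * Φ.E i * (c * Φ.Es l) := by rw [(hcE i).eq]; simp only [mul_assoc]
            _ = 0 := by rw [hr l hlt, mul_zero]
        rw [this]
        exact zero_mem _
    · rintro y ⟨-, h2, -, -⟩ l hl
      rw [← h2, mul_assoc, Φ.mul_Es, if_neg, mul_zero]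
      rintro rfl
      omega
    · intro y hy
      rwa [hy.2.1]
  | succ d ih =>
    obtain ⟨N, hcN, hN, hNs, hNr⟩ := ih
    -- Allow one more final index, `r + 1 + d`; closure of this span under further letters is what
    -- elimination supplies.
    let Q : Submodule K 𝒜 := Submodule.span K
      {z | ∃ y ∈ N, ∃ k m : Fin n, m.1 ≤ r.1 + 1 + d ∧ z = y * Φ.E k * Φ.Es m}
    have hQ : ∀ y ∈ N, ∀ k m : Fin n, m.1 ≤ r.1 + 1 + d → y * Φ.E k * Φ.Es m ∈ Q :=
      fun y hy k m hm => Submodule.subset_span ⟨y, hy, k, m, hm, rfl⟩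
    have hsum : ∀ y a, y * a = ∑ k, y * Φ.E k * a := by
      intro y a
      rw [← Finset.sum_mul, ← Finset.mul_sum, Φ.sum_E, mul_one]
    have hsums : ∀ y, y = ∑ j, y * Φ.Es j := by
      intro y
      rw [← Finset.mul_sum, Φ.sum_Es, mul_one]
    have hNEs : ∀ y ∈ N, ∀ j : Fin n, j.1 < r.1 + 1 + d → y * Φ.Es j ∈ N := by
      intro y hy j hj
      rw [hsum]
      exact sum_mem fun k _ => hN y hy k j hj
    refine ⟨Q, ?_, ?_, ?_, ?_⟩
    · have : c * Φ.Es r = (c * Φ.Es r) * Φ.Es r := by rw [mul_assoc, hEsr]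
      rw [this, hsum]
      exact sum_mem fun k _ => hQ _ hcN k r (by omega)
    · intro z hz i l hl
      induction hz using Submodule.span_induction with
      | zero => simp
      | add a b _ _ ha hb => rw [add_mul, add_mul]; exact add_mem ha hb
      | smul t a _ ha => rw [smul_mul_assoc, smul_mul_assoc]; exact Q.smul_mem t ha
      | mem z hz =>
        obtain ⟨y, hy, k, m, hm, rfl⟩ := hz
        -- Splitting `y` by its last dual idempotent gives the index `j < r + 1 + d` that the
        -- elimination requires; the other pieces are zero.
        rw [hsums y]
        simp only [Finset.sum_mul]
        refine sum_mem fun j _ => ?_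
        by_cases hj : j.1 < r.1 + 1 + d
        · exact Φ.mul_mem_of_elimination N (r.1 + 1 + d) hN Q l (by omega)
            (fun y hy k => hQ y hy k l (by omega)) j hj _ (hNEs y hy j hj)
            (by rw [mul_assoc, Φ.mul_Es, if_pos rfl]) k m i
        · rw [hNs y hy j (by omega)]
          simp
    · intro z hz l hl
      induction hz using Submodule.span_induction with
      | zero => simp
      | add a b _ _ ha hb => rw [add_mul, ha, hb, add_zero]
      | smul t a _ ha => rw [smul_mul_assoc, ha, smul_zero]
      | mem z hz =>
        obtain ⟨y, hy, k, m, hm, rfl⟩ := hz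
        rw [mul_assoc, Φ.mul_Es, if_neg, mul_zero]
        rintro rfl
        omega
    · intro z hz
      induction hz using Submodule.span_induction with
      | zero => simp
      | add a b _ _ ha hb => rw [add_mul]; exact add_mem ha hb
      | smul t a _ ha => rw [smul_mul_assoc]; exact Submodule.smul_mem _ t ha
      | mem z hz =>
        obtain ⟨y, hy, k, m, hm, rfl⟩ := hz
        by_cases hmr : m = r
        · subst hmr
          exact hNr _ (hN y hy k m (by omega))
        · rw [mul_assoc, Φ.mul_Es, if_neg hmr, mul_zero]
          exact zero_mem _

/-- An antiautomorphism fixing all `E i`, `Es i` fixes the corner at `c * Es r` pointwise, if `c` is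
a fixed central idempotent and `r` is minimal with `c * Es r ≠ 0`. -/
theorem map_corner_eq {c : 𝒜} {r : Fin n} {σ : 𝒜 →ₗ[K] 𝒜}
    (hσ : ∀ a b, σ (a * b) = σ b * σ a) (hσE : ∀ i, σ (Φ.E i) = Φ.E i)
    (hσEs : ∀ i, σ (Φ.Es i) = Φ.Es i) (hσc : σ c = c)
    (hc : c * c = c) (hcE : ∀ i, Commute c (Φ.E i)) (hcEs : ∀ i, Commute c (Φ.Es i))
    (hr : ∀ l, l.1 < r.1 → c * Φ.Es l = 0) {t : 𝒜}
    (ht : t ∈ Algebra.adjoin K (Set.range Φ.E ∪ Set.range Φ.Es)) :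
    σ (c * Φ.Es r * t * Φ.Es r) = c * Φ.Es r * t * Φ.Es r := by
  -- With `d = n` the bound on `l` is no restriction, so `N` is stable under the whole algebra.
  obtain ⟨N, hcN, hN, -, hNr⟩ := exists_submodule_mul_closed hσ hσE hσEs hσc hc hcE hcEs hr n
  have hmul : ∀ y ∈ N, y * t ∈ N := by
    induction ht using Algebra.adjoin_induction with
    | mem t ht =>
      intro y hy
      rcases ht with ⟨i, rfl⟩ | ⟨l, rfl⟩
      · have : y * Φ.E i = ∑ l, y * Φ.E i * Φ.Es l := by
          rw [← Finset.mul_sum, Φ.sum_Es, mul_one]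
        rw [this]
        exact sum_mem fun l _ => hN y hy i l (by omega)
      · have : y * Φ.Es l = ∑ i, y * Φ.E i * Φ.Es l := by
          rw [← Finset.sum_mul, ← Finset.mul_sum, Φ.sum_E, mul_one]
        rw [this]
        exact sum_mem fun i _ => hN y hy i l (by omega)
    | algebraMap a =>
      intro y hy
      rw [Algebra.algebraMap_eq_smul_one, mul_smul_comm, mul_one]
      exact N.smul_mem a hy
    | add a b _ _ ha hb =>
      intro y hy
      rw [mul_add]
      exact add_mem (ha y hy) (hb y hy)
    | mul a b _ _ ha hb =>
      intro y hy
      rw [← mul_assoc]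
      exact hb _ (ha y hy)
  exact (hNr _ (hmul _ hcN)).2.2.1

end Corner

end TridiagonalIdempotents

/-! ### Distance matrices and the algebra generated by the adjacency matrix -/

theorem Submodule.mem_of_mem_adjoin_singleton {K 𝒜 : Type*} [Field K] [Ring 𝒜] [Algebra K 𝒜]
    {S : Submodule K 𝒜} {a b : 𝒜} (hpow : ∀ n : ℕ, a ^ n ∈ S) (hb : b ∈ Algebra.adjoin K {a}) :
    b ∈ S := by
  rw [Algebra.adjoin_singleton_eq_range_aeval] at hb
  obtain ⟨P, rfl⟩ := hb
  change Polynomial.aeval a P ∈ S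
  rw [Polynomial.aeval_eq_sum_range]
  exact sum_mem fun n _ => S.smul_mem _ (hpow n)

/-- The matrices having the same entry in two given positions. -/
def entriesEq {X : Type*} (y z y' z' : X) : Submodule ℝ (Matrix X X ℝ) where
  carrier := {B | B y z = B y' z'}
  zero_mem' := rfl
  add_mem' := fun {a b} ha hb => by
    change a y z + b y z = a y' z' + b y' z'
    rw [show a y z = _ from ha, show b y z = _ from hb]
  smul_mem' := fun t a ha => by
    change t • a y z = t • a y' z'
    rw [show a y z = _ from ha]

theorem mem_entriesEq {X : Type*} {y z y' z' : X} {B : Matrix X X ℝ} :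
    B ∈ entriesEq y z y' z' ↔ B y z = B y' z' := Iff.rfl

section DistanceMatrices

variable {X : Type*} {G : SimpleGraph X}

theorem SimpleGraph.Connected.exists_dist_eq_of_le_dist (hG : G.Connected) {y z : X} {l : ℕ}
    (h : l ≤ G.dist y z) : ∃ w, G.dist y w = l ∧ G.dist w z = G.dist y z - l := by
  obtain ⟨p, hp⟩ := hG.exists_walk_length_eq_dist y z
  refine ⟨p.getVert l, ?_⟩
  have h1 := SimpleGraph.dist_le (p.take l)
  have h2 := SimpleGraph.dist_le (p.drop l)
  rw [SimpleGraph.Walk.take_length] at h1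
  rw [SimpleGraph.Walk.drop_length] at h2
  have h3 := hG.dist_triangle (u := y) (v := p.getVert l) (w := z)
  omega

theorem SimpleGraph.Connected.exists_dist_eq_of_le_diam [Finite X] (hG : G.Connected) {l : ℕ}
    (h : l ≤ G.diam) : ∃ y z, G.dist y z = l := by
  have := hG.nonempty
  obtain ⟨y, z, hyz⟩ := G.exists_dist_eq_diam
  obtain ⟨w, hw, -⟩ := hG.exists_dist_eq_of_le_dist (h.trans hyz.ge)
  exact ⟨y, w, hw⟩

theorem SimpleGraph.Connected.dist_lt_diam_succ [Finite X] (hG : G.Connected) (y z : X) :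
    G.dist y z < G.diam + 1 := by
  have := hG.nonempty
  exact Nat.lt_succ_of_le (SimpleGraph.dist_le_diam
    (SimpleGraph.connected_iff_ediam_ne_top.1 hG))

theorem distMatrix_apply {𝕜 : Type*} [Field 𝕜] (i : ℕ) (y z : X) :
    distMatrix G 𝕜 i y z = if G.dist y z = i then 1 else 0 := rfl

theorem distMatrix_transpose {𝕜 : Type*} [Field 𝕜] (i : ℕ) :
    (distMatrix G 𝕜 i).transpose = distMatrix G 𝕜 i := by
  ext y z
  rw [Matrix.transpose_apply, distMatrix_apply, distMatrix_apply, SimpleGraph.dist_comm]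

theorem distMatrix_isHermitian (l : ℕ) : (distMatrix G ℝ l).IsHermitian := by
  rw [Matrix.IsHermitian, Matrix.conjTranspose_eq_transpose_of_trivial, distMatrix_transpose]

theorem distMatrix_zero {𝕜 : Type*} [Field 𝕜] [DecidableEq X] (hG : G.Connected) :
    distMatrix G 𝕜 0 = 1 := by
  ext y z
  rw [distMatrix_apply, Matrix.one_apply]
  simp only [hG.dist_eq_zero_iff]

variable [Fintype X]

theorem distMatrix_one_mul_apply (B : Matrix X X ℝ) (y z : X) :
    (distMatrix G ℝ 1 * B) y z = ∑ w with G.dist y w = 1, B w z := by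
  simp [Matrix.mul_apply, distMatrix_apply, Finset.sum_filter]

theorem distMatrix_one_mul_distMatrix (hG : G.Connected) {p : ℕ → ℕ → ℕ → ℕ}
    (hp : ∀ h i j : ℕ, ∀ y z : X, G.dist y z = h →
      (Finset.univ.filter fun w : X => G.dist y w = i ∧ G.dist z w = j).card = p h i j) (l : ℕ) :
    distMatrix G ℝ 1 * distMatrix G ℝ l =
      ∑ h ∈ Finset.range (l + 2), (p h 1 l : ℝ) • distMatrix G ℝ h := by
  ext y z
  have h1 : (distMatrix G ℝ 1 * distMatrix G ℝ l) y z = p (G.dist y z) 1 l := by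
    rw [distMatrix_one_mul_apply, ← hp _ 1 l y z rfl, ← Finset.filter_filter]
    simp [distMatrix_apply, G.dist_comm (v := z)]
  rw [h1, Matrix.sum_apply]
  simp only [Matrix.smul_apply, distMatrix_apply, smul_eq_mul, mul_ite, mul_one, mul_zero,
    Finset.sum_ite_eq, Finset.mem_range]
  split_ifs with h
  · rfl
  · rw [← hp _ 1 l y z rfl, Nat.cast_eq_zero, Finset.card_eq_zero, Finset.filter_eq_empty_iff]
    rintro w - ⟨h1, h2⟩
    have := hG.dist_triangle (u := y) (v := w) (w := z)
    rw [G.dist_comm (u := w)] at this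
    omega

/-- The three-term recurrence for `A_1 A_l` can be solved for `A_{l+1}`, its coefficient there being
nonzero by taking a neighbour on a geodesic. -/
theorem distMatrix_mem_adjoin [DecidableEq X] (hG : IsDistanceRegular G) (l : ℕ)
    (hl : l ≤ G.diam) :
    distMatrix G ℝ l ∈ Algebra.adjoin ℝ {distMatrix G ℝ 1} := by
  obtain ⟨hconn, p, hp⟩ := hG
  induction l using Nat.strong_induction_on with
  | _ l ih =>
    cases l with
    | zero =>
      rw [distMatrix_zero hconn]
      exact one_mem _
    | succ l =>
      have hne : (p (l + 1) 1 l : ℝ) ≠ 0 := by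
        obtain ⟨y, z, hyz⟩ := hconn.exists_dist_eq_of_le_diam hl
        obtain ⟨w, h1, h2⟩ := hconn.exists_dist_eq_of_le_dist (y := y) (z := z) (l := 1) (by omega)
        rw [Nat.cast_ne_zero, ← hp (l + 1) 1 l y z hyz]
        refine Finset.card_ne_zero_of_mem (a := w) ?_
        simp only [Finset.mem_filter, Finset.mem_univ, true_and]
        exact ⟨h1, by rw [G.dist_comm]; omega⟩
      have key := distMatrix_one_mul_distMatrix hconn hp l
      rw [Finset.sum_range_succ, ← sub_eq_iff_eq_add'] at key
      rw [← inv_smul_smul₀ hne (distMatrix G ℝ (l + 1)), ← key]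
      refine Subalgebra.smul_mem _ (sub_mem (mul_mem (Algebra.self_mem_adjoin_singleton ℝ _)
        (ih l (by omega) (by omega))) (sum_mem fun h hh => Subalgebra.smul_mem _ (ih h ?_ ?_) _)) _
      all_goals simp at hh; omega

theorem apply_eq_of_mem_adjoin_distMatrix [DecidableEq X] (hG : IsDistanceRegular G)
    {B : Matrix X X ℝ} (hB : B ∈ Algebra.adjoin ℝ {distMatrix G ℝ 1}) {y z y' z' : X}
    (h : G.dist y z = G.dist y' z') : B y z = B y' z' := by
  obtain ⟨hconn, p, hp⟩ := hG
  have step : ∀ C : Matrix X X ℝ, (∀ y z y' z', G.dist y z = G.dist y' z' → C y z = C y' z') →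
      ∀ y z y' z', G.dist y z = G.dist y' z' →
        (distMatrix G ℝ 1 * C) y z = (distMatrix G ℝ 1 * C) y' z' := by
    intro C hC y z y' z' h
    -- Neighbours of `y` are sorted by their distance to `z`: on each class `C` is constant, and the
    -- class size is an intersection number.
    have key : ∀ y z, (distMatrix G ℝ 1 * C) y z =
        ∑ j ∈ Finset.range (G.diam + 1), ∑ w with G.dist y w = 1 ∧ G.dist z w = j, C w z := by
      intro y z
      rw [distMatrix_one_mul_apply, ← Finset.sum_fiberwise_of_maps_to
        (g := fun w => G.dist z w) (t := Finset.range (G.diam + 1))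
        fun w _ => Finset.mem_range.2 (hconn.dist_lt_diam_succ z w)]
      simp only [Finset.filter_filter]
    rw [key, key]
    refine Finset.sum_congr rfl fun j _ => ?_
    have hcard := (hp _ 1 j y z rfl).trans ((congrArg (p · 1 j) h).trans (hp _ 1 j y' z' rfl).symm)
    obtain hempty | ⟨w, hw⟩ :=
      (Finset.univ.filter fun w : X => G.dist y w = 1 ∧ G.dist z w = j).eq_empty_or_nonempty
    · rw [hempty, Finset.card_empty, eq_comm, Finset.card_eq_zero] at hcard
      rw [hempty, hcard, Finset.sum_empty, Finset.sum_empty]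
    · have hw' : G.dist w z = j := by
        rw [G.dist_comm]; exact (Finset.mem_filter.1 hw).2.2
      rw [Finset.sum_eq_card_nsmul (b := C w z), Finset.sum_eq_card_nsmul (b := C w z), hcard]
      · intro u hu
        refine hC _ _ _ _ ?_
        rw [hw', G.dist_comm]; exact (Finset.mem_filter.1 hu).2.2
      · intro u hu
        refine hC _ _ _ _ ?_
        rw [hw', G.dist_comm]; exact (Finset.mem_filter.1 hu).2.2
  have hpow : ∀ n : ℕ, ∀ y z y' z', G.dist y z = G.dist y' z' →
      (distMatrix G ℝ 1 ^ n) y z = (distMatrix G ℝ 1 ^ n) y' z' := by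
    intro n
    induction n with
    | zero =>
      intro y z y' z' h
      rw [pow_zero, ← distMatrix_zero hconn, distMatrix_apply, distMatrix_apply, h]
    | succ n ih =>
      rw [pow_succ']
      exact step _ ih
  exact Submodule.mem_of_mem_adjoin_singleton (S := entriesEq y z y' z')
    (fun n => hpow n y z y' z' h) hB

end DistanceMatrices

/-! ### Primitive idempotents and the `Q`-polynomial property -/

section PrimitiveIdempotents

variable {X : Type*} [Fintype X] [DecidableEq X]

/-- A symmetric matrix has an eigenbasis, so matrix identities can be tested on its eigenvectors. -/
theorem Matrix.IsHermitian.ext_of_eigenvector {A M N : Matrix X X ℝ} (hA : A.IsHermitian)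
    (h : ∀ (t : ℝ) (v : X → ℝ), v ≠ 0 → A.mulVec v = t • v → M.mulVec v = N.mulVec v) : M = N := by
  have hb : ∀ b, M.mulVec (hA.eigenvectorBasis b) = N.mulVec (hA.eigenvectorBasis b) := by
    intro b
    refine h (hA.eigenvalues b) _ ?_ (hA.mulVec_eigenvectorBasis b)
    intro h0
    refine hA.eigenvectorBasis.toBasis.ne_zero b ?_
    ext i
    simpa using congrFun h0 i
  have hlin : Matrix.toLpLin 2 2 M = Matrix.toLpLin 2 2 N := by
    refine hA.eigenvectorBasis.toBasis.ext fun b => ?_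
    simp only [OrthonormalBasis.coe_toBasis, Matrix.toLpLin_apply]
    rw [hb]
  exact (Matrix.toLpLin 2 2).injective hlin

variable {G : SimpleGraph X}

/-- The properties of the primitive idempotents `E` of the adjacency matrix, for eigenvalues `θ`. -/
structure IsSpectralResolution (G : SimpleGraph X) (E : Fin (G.diam + 1) → Matrix X X ℝ)
    (θ : Fin (G.diam + 1) → ℝ) : Prop where
  injective : Function.Injective θ
  mul : ∀ i j, E i * E j = if i = j then E i else 0
  sum : ∑ i, E i = 1
  sum_smul : ∑ i, θ i • E i = distMatrix G ℝ 1
  ne_zero : ∀ i, E i ≠ 0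
  mem_adjoin : ∀ i, E i ∈ Algebra.adjoin ℝ {distMatrix G ℝ 1}

theorem aeval_mulVec_of_mulVec_eq_smul {A : Matrix X X ℝ} {v : X → ℝ} {t : ℝ}
    (h : A.mulVec v = t • v) (P : Polynomial ℝ) :
    (Polynomial.aeval A P).mulVec v = P.eval t • v := by
  induction P using Polynomial.induction_on' with
  | add P Q hP hQ => rw [map_add, Matrix.add_mulVec, hP, hQ, Polynomial.eval_add, add_smul]
  | monomial n a =>
    have hpow : (A ^ n).mulVec v = t ^ n • v := by
      induction n with
      | zero => simp
      | succ n ih =>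
        rw [pow_succ, ← Matrix.mulVec_mulVec, h, Matrix.mulVec_smul, ih, smul_smul, pow_succ']
    rw [Polynomial.aeval_monomial, Polynomial.eval_monomial, Algebra.algebraMap_eq_smul_one,
      smul_mul_assoc, one_mul, Matrix.smul_mulVec, hpow, smul_smul]

theorem IsPrimitiveIdempotentOrdering.exists_isSpectralResolution
    {E : Fin (G.diam + 1) → Matrix X X ℝ} (hE : IsPrimitiveIdempotentOrdering G E) :
    ∃ θ, IsSpectralResolution G E θ := by
  obtain ⟨θ, hθ, heig, -, hE1, hE0⟩ := hE
  have hA := distMatrix_isHermitian (G := G) 1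
  have hv : ∀ j v, (distMatrix G ℝ 1).mulVec v = θ j • v →
      ∀ i, (E i).mulVec v = if i = j then v else 0 := by
    intro j v hv i
    split_ifs with h
    · subst h; exact hE1 i v hv
    · exact hE0 i j h v hv
  have hext : ∀ M N : Matrix X X ℝ, (∀ j v, (distMatrix G ℝ 1).mulVec v = θ j • v →
      M.mulVec v = N.mulVec v) → M = N := by
    intro M N h
    refine hA.ext_of_eigenvector fun t v hv0 hv => ?_
    obtain ⟨j, rfl⟩ := (heig t).1 (Module.End.hasEigenvalue_of_hasEigenvector
      ⟨Module.End.mem_eigenspace_iff.2 (by rwa [Matrix.toLin'_apply]), hv0⟩)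
    exact h j v hv
  refine ⟨θ, hθ, ?_, ?_, ?_, ?_, ?_⟩
  · intro i j
    refine hext _ _ fun k v hk => ?_
    rw [← Matrix.mulVec_mulVec, hv k v hk j]
    by_cases hij : i = j
    · subst hij
      by_cases hik : i = k
      · simp [hik, hv k v hk k]
      · simp [hik, hv k v hk i]
    · by_cases hjk : j = k
      · subst hjk
        simp [hij, hv j v hk i]
      · simp [hij, hjk]
  · refine hext _ _ fun k v hk => ?_
    simp [Matrix.sum_mulVec, hv k v hk]
  · refine hext _ _ fun k v hk => ?_
    simp [Matrix.sum_mulVec, Matrix.smul_mulVec, hv k v hk, hk]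
  · intro i hi
    obtain ⟨v, hv1, hv2⟩ := ((heig (θ i)).2 ⟨i, rfl⟩).exists_hasEigenvector
    rw [Module.End.mem_eigenspace_iff, Matrix.toLin'_apply] at hv1
    have := hE1 i v hv1
    rw [hi, Matrix.zero_mulVec] at this
    exact hv2 this.symm
  · intro i
    have : E i = Polynomial.aeval (distMatrix G ℝ 1) (Lagrange.basis Finset.univ θ i) := by
      refine hext _ _ fun k v hk => ?_
      rw [aeval_mulVec_of_mulVec_eq_smul hk, hv k v hk]
      split_ifs with h
      · subst h
        rw [Lagrange.eval_basis_self hθ.injOn (Finset.mem_univ _), one_smul]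
      · rw [Lagrange.eval_basis_of_ne h (Finset.mem_univ _), zero_smul]
    rw [this, Algebra.adjoin_singleton_eq_range_aeval]
    exact ⟨_, rfl⟩

namespace IsSpectralResolution

variable {E : Fin (G.diam + 1) → Matrix X X ℝ} {θ : Fin (G.diam + 1) → ℝ}

theorem transpose_eq (hE : IsSpectralResolution G E θ) (i : Fin (G.diam + 1)) :
    (E i).transpose = E i := by
  refine Submodule.mem_of_mem_adjoin_singleton
    (S := LinearMap.eqLocus (Matrix.transposeLinearEquiv X X ℝ ℝ).toLinearMap LinearMap.id)
    (fun n => ?_) (hE.mem_adjoin i)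
  change (distMatrix G ℝ 1 ^ n).transpose = distMatrix G ℝ 1 ^ n
  rw [Matrix.transpose_pow, distMatrix_transpose]

theorem distMatrix_mem_span (hE : IsSpectralResolution G E θ) (hG : IsDistanceRegular G) {l : ℕ}
    (hl : l ≤ G.diam) : distMatrix G ℝ l ∈ Submodule.span ℝ (Set.range E) := by
  refine Submodule.mem_of_mem_adjoin_singleton (fun n => ?_) (distMatrix_mem_adjoin hG l hl)
  rw [← hE.sum_smul, sum_smul_pow_of_orthogonal hE.mul hE.sum]
  exact sum_mem fun i _ => Submodule.smul_mem _ _ (Submodule.subset_span ⟨i, rfl⟩)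

theorem apply_eq (hE : IsSpectralResolution G E θ) (hG : IsDistanceRegular G)
    (i : Fin (G.diam + 1)) {y z y' z' : X} (h : G.dist y z = G.dist y' z') :
    E i y z = E i y' z' :=
  apply_eq_of_mem_adjoin_distMatrix hG (hE.mem_adjoin i) h

/-- Two matrix positions at different distances are separated by the primitive idempotents. -/
theorem dist_eq_of_forall_apply_eq (hE : IsSpectralResolution G E θ) (hG : IsDistanceRegular G)
    {y z y' z' : X} (h : ∀ i, E i y z = E i y' z') : G.dist y z = G.dist y' z' := by
  have hle : Submodule.span ℝ (Set.range E) ≤ entriesEq y z y' z' := by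
    rw [Submodule.span_le]
    rintro _ ⟨i, rfl⟩
    exact h i
  have := hle (hE.distMatrix_mem_span hG (Nat.lt_succ_iff.1 (hG.1.dist_lt_diam_succ y z)))
  rw [mem_entriesEq, distMatrix_apply, distMatrix_apply, if_pos rfl] at this
  split_ifs at this with h'
  · exact h'.symm
  · exact absurd this one_ne_zero

/-- For a `Q`-polynomial ordering the zeroth idempotent is a multiple of the all-ones matrix. -/
theorem zero_apply_eq (hE : IsSpectralResolution G E θ) (hG : IsDistanceRegular G)
    {lam : Fin (G.diam + 1) → ℝ} (hlam : ∀ j, Matrix.hadamard (E 0) (E j) = lam j • E j)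
    (y z y' z' : X) : E 0 y z = E 0 y' z' := by
  have hdiag : ∀ y z : X, E 0 y y = E 0 z z := fun y z => hE.apply_eq hG 0 (by simp)
  -- Summing the hypothesis over `j` gives `∑ lam j • E j = E 0 ∘ 1`, a scalar matrix, so all `lam
  -- j` coincide.
  have hconst : ∀ j, lam j = E 0 y y := by
    intro j
    have h1 : ∑ i, lam i • E i = E 0 y y • (1 : Matrix X X ℝ) := by
      simp_rw [← hlam]
      ext u v
      have : ∑ i, E i u v = (1 : Matrix X X ℝ) u v := by rw [← hE.sum, Matrix.sum_apply]
      rw [Matrix.sum_apply]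
      simp only [Matrix.hadamard_apply]
      rw [← Finset.mul_sum, this, Matrix.smul_apply, smul_eq_mul]
      by_cases huv : u = v
      · rw [huv, hdiag v y]
      · rw [Matrix.one_apply_ne huv, mul_zero, mul_zero]
    have h2 := congrArg (· * E j) h1
    simp only [Finset.sum_mul, smul_mul_assoc, hE.mul, one_mul] at h2
    rw [Finset.sum_eq_single j (fun i _ hi => by rw [if_neg hi, smul_zero]) (by simp),
      if_pos rfl, ← sub_eq_zero, ← sub_smul] at h2
    exact sub_eq_zero.1 ((smul_eq_zero.1 h2).resolve_right (hE.ne_zero j))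
  have key : ∀ u v : X, E 0 u v = E 0 y y := by
    intro u v
    by_contra hne
    -- Otherwise every `E j`, hence every distance matrix, would vanish at `(u, v)`.
    have hzero : ∀ j, E j u v = 0 := by
      intro j
      have := congrFun (congrFun (hlam j) u) v
      rw [Matrix.hadamard_apply, Matrix.smul_apply, smul_eq_mul, hconst, ← sub_eq_zero,
        ← sub_mul] at this
      exact (mul_eq_zero.1 this).resolve_left (sub_ne_zero.2 hne)
    have hle : Submodule.span ℝ (Set.range E) ≤
        LinearMap.ker (Matrix.entryLinearMap ℝ ℝ u v) := by
      rw [Submodule.span_le]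
      rintro _ ⟨i, rfl⟩
      exact hzero i
    have := hle (hE.distMatrix_mem_span hG (Nat.lt_succ_iff.1 (hG.1.dist_lt_diam_succ u v)))
    simp [distMatrix_apply] at this
  rw [key y z, key y' z']

/-- For a `Q`-polynomial ordering the entries of `E 1` at different distances are different. -/
theorem dist_eq_of_one_apply_eq (hE : IsSpectralResolution G E θ) (hG : IsDistanceRegular G)
    {q : Fin (G.diam + 1) → Fin (G.diam + 1) → Fin (G.diam + 1) → ℝ}
    (hq : IsKreinParameters G E q)
    (hQ : ∀ h i j : Fin (G.diam + 1),
        ((i : ℕ) + j < h ∨ (h : ℕ) + j < i ∨ (h : ℕ) + i < j → q h i j = 0) ∧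
        ((h : ℕ) = i + j ∨ (i : ℕ) = h + j ∨ (j : ℕ) = h + i → q h i j ≠ 0))
    {e : Fin (G.diam + 1)} (he : e.1 = 1) {y z y' z' : X} (h : E e y z = E e y' z') :
    G.dist y z = G.dist y' z' := by
  have hcard : (Fintype.card X : ℝ)⁻¹ ≠ 0 := by
    have : Nonempty X := ⟨y⟩
    simp
  have h0 : E 0 y z = E 0 y' z' := by
    refine hE.zero_apply_eq hG (lam := fun j => (Fintype.card X : ℝ)⁻¹ * q j 0 j)
      (fun j => ?_) _ _ _ _
    rw [hq 0 j, Finset.sum_eq_single j, mul_smul]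
    · intro k _ hk
      have : k.1 ≠ j.1 := fun h => hk (Fin.ext h)
      rw [(hQ k 0 j).1 (by simp; omega), zero_smul]
    · simp
  refine hE.dist_eq_of_forall_apply_eq hG ?_
  -- In `E 1 ∘ E N` the highest term is a nonzero multiple of `E (N + 1)`, so equality of two
  -- entries propagates upwards from `E 0` and `E 1`.
  have main : ∀ N : ℕ, ∀ i : Fin (G.diam + 1), i.1 ≤ N → E i ∈ entriesEq y z y' z' := by
    intro N
    induction N with
    | zero =>
      intro i hi
      have : i = 0 := Fin.ext (by simpa using hi)
      rw [this]
      exact h0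
    | succ N ih =>
      intro i hi
      by_cases hiN : i.1 ≤ N
      · exact ih i hiN
      let j : Fin (G.diam + 1) := ⟨N, by omega⟩
      have hmem : ∑ k, q k e j • E k ∈ entriesEq y z y' z' := by
        have h1 : Matrix.hadamard (E e) (E j) ∈ entriesEq y z y' z' := by
          rw [mem_entriesEq, Matrix.hadamard_apply, Matrix.hadamard_apply, h,
            mem_entriesEq.1 (ih j le_rfl)]
        rw [hq e j] at h1
        exact (Submodule.smul_mem_iff _ hcard).1 h1
      rw [← Finset.add_sum_erase _ _ (Finset.mem_univ i)] at hmem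
      have hrest : ∑ k ∈ Finset.univ.erase i, q k e j • E k ∈ entriesEq y z y' z' := by
        refine sum_mem fun k hk => ?_
        have hki : k.1 ≠ i.1 := fun h => Finset.ne_of_mem_erase hk (Fin.ext h)
        by_cases hkN : k.1 ≤ N
        · exact Submodule.smul_mem _ _ (ih k hkN)
        · rw [(hQ k e j).1 (Or.inl (by simp only [j]; omega)), zero_smul]
          exact zero_mem _
      exact (Submodule.smul_mem_iff _ ((hQ i e j).2 (Or.inl (by simp only [j]; omega)))).1
        ((Submodule.add_mem_iff_left _ hrest).1 hmem)
  exact fun i => main i.1 i le_rfl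

/-- The vanishing of a Krein parameter `q^e_{ik}` gives a triple product relation with the dual
idempotents. -/
theorem mul_diagonal_mul_eq_zero (hE : IsSpectralResolution G E θ)
    {q : Fin (G.diam + 1) → Fin (G.diam + 1) → Fin (G.diam + 1) → ℝ}
    (hq : IsKreinParameters G E q) {e i k : Fin (G.diam + 1)} (h : q e i k = 0) (x : X) :
    E i * Matrix.diagonal (E e x) * E k = 0 := by
  have hsymm : ∀ i u v, E i u v = E i v u := fun i u v => congrFun (congrFun (hE.transpose_eq i) v) u
  -- The squared norm of the product equals `⟨(E i ∘ E k) v, v⟩` for `v = E e x`. As `v` lies in the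
  -- image of `E e`, only the term with coefficient `q e i k` survives.
  rw [← Matrix.trace_conjTranspose_mul_self_eq_zero_iff,
    Matrix.conjTranspose_eq_transpose_of_trivial]
  have h1 : ((E i * Matrix.diagonal (E e x) * E k).transpose *
      (E i * Matrix.diagonal (E e x) * E k)).trace =
      (E k * Matrix.diagonal (E e x) * (E i * Matrix.diagonal (E e x))).trace := by
    rw [Matrix.transpose_mul, Matrix.transpose_mul, hE.transpose_eq, hE.transpose_eq,
      Matrix.diagonal_transpose, ← Matrix.mul_assoc, Matrix.trace_mul_comm]
    have hi : E i * E i = E i := by rw [hE.mul, if_pos rfl]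
    have hk : E k * E k = E k := by rw [hE.mul, if_pos rfl]
    congr 1
    calc _ = (E k * E k) * Matrix.diagonal (E e x) * ((E i * E i) * Matrix.diagonal (E e x)) := by
          simp only [Matrix.mul_assoc]
      _ = _ := by rw [hi, hk]
  have h2 : (E k * Matrix.diagonal (E e x) * (E i * Matrix.diagonal (E e x))).trace =
      (Matrix.hadamard (E i) (E k)).mulVec (E e x) ⬝ᵥ E e x := by
    refine Finset.sum_congr rfl fun u _ => ?_
    rw [Matrix.diag_apply, Matrix.mul_apply, Matrix.mulVec, dotProduct, Finset.sum_mul]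
    refine Finset.sum_congr rfl fun v _ => ?_
    rw [Matrix.mul_diagonal, Matrix.mul_diagonal, Matrix.hadamard_apply, hsymm i v u]
    ring
  have h3 : ∀ l, (E l).mulVec (E e x) = if l = e then E e x else 0 := by
    intro l
    have : E e x = (E e).mulVec (Pi.single x 1) := by
      rw [Matrix.mulVec_single_one]
      funext u
      exact hsymm e x u
    rw [this, Matrix.mulVec_mulVec, hE.mul]
    split_ifs with hl
    · rw [hl]
    · rw [Matrix.zero_mulVec]
  rw [h1, h2, hq i k, Matrix.smul_mulVec, Matrix.sum_mulVec, Finset.sum_eq_zero]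
  · simp
  · intro l _
    rw [Matrix.smul_mulVec, h3]
    split_ifs with hl
    · rw [hl, h, zero_smul]
    · rw [smul_zero]

end IsSpectralResolution

end PrimitiveIdempotents

/-! ### The tridiagonal system of a graph and a base vertex -/

section Construction

variable {X : Type*} [Fintype X] [DecidableEq X] {G : SimpleGraph X}

theorem dualIdempotent_mul (x : X) (i j : ℕ) :
    dualIdempotent G x ℝ i * dualIdempotent G x ℝ j =
      if i = j then dualIdempotent G x ℝ i else 0 := by
  rw [dualIdempotent, dualIdempotent, Matrix.diagonal_mul_diagonal]
  split_ifs with h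
  · subst h
    congr 1
    funext y
    simp
  · rw [← Matrix.diagonal_zero]
    congr 1
    funext y
    simp only [mul_ite, mul_one, mul_zero]
    split_ifs <;> simp_all

theorem sum_smul_dualIdempotent (hG : G.Connected) (x : X) (c : Fin (G.diam + 1) → ℝ) :
    ∑ l, c l • dualIdempotent G x ℝ l.1 =
      Matrix.diagonal fun y => c ⟨G.dist x y, hG.dist_lt_diam_succ x y⟩ := by
  ext y z
  rw [Matrix.sum_apply]
  by_cases hyz : y = z
  · subst hyz
    simp only [dualIdempotent, Matrix.smul_apply, Matrix.diagonal_apply_eq, smul_eq_mul]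
    rw [Finset.sum_eq_single ⟨G.dist x y, hG.dist_lt_diam_succ x y⟩]
    · simp
    · intro l _ hl
      rw [if_neg, mul_zero]
      intro h
      exact hl (Fin.ext h.symm)
    · simp
  · simp [dualIdempotent, hyz]

theorem dualIdempotent_mul_adjacency_mul (hG : G.Connected) (x : X) {i k : ℕ}
    (h : 1 + i < k ∨ 1 + k < i) :
    dualIdempotent G x ℝ i * distMatrix G ℝ 1 * dualIdempotent G x ℝ k = 0 := by
  ext y z
  rw [dualIdempotent, dualIdempotent, Matrix.mul_diagonal, Matrix.diagonal_mul, distMatrix_apply]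
  have h1 := hG.dist_triangle (u := x) (v := y) (w := z)
  have h2 := hG.dist_triangle (u := x) (v := z) (w := y)
  rw [G.dist_comm (u := z)] at h2
  split_ifs <;> simp
  omega

/-- The primitive idempotents of a `Q`-polynomial distance-regular graph and its dual idempotents
with respect to a vertex are mutually tridiagonal. -/
theorem exists_tridiagonalIdempotents (hG : IsDistanceRegular G) (hdiam : 1 ≤ G.diam)
    (hQ : IsQPolynomial G) (x : X) :
    ∃ (Φ : TridiagonalIdempotents ℝ (Matrix X X ℝ) (G.diam + 1)),
      IsSpectralResolution G Φ.E Φ.θ ∧ ∀ l, Φ.Es l = dualIdempotent G x ℝ l.1 := by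
  obtain ⟨E, hord, q, hq, hqz⟩ := hQ
  obtain ⟨θ, hE⟩ := hord.exists_isSpectralResolution
  have hex : ∀ l : Fin (G.diam + 1), ∃ y z, G.dist y z = l.1 := fun l =>
    hG.1.exists_dist_eq_of_le_diam (Nat.lt_succ_iff.1 l.2)
  choose y z hyz using hex
  let e : Fin (G.diam + 1) := ⟨1, by omega⟩
  -- Up to the factor `|X|` this is the dual adjacency matrix; its eigenvalues are the entries of `E
  -- 1` at each distance.
  have hdual : ∑ l, E e (y l) (z l) • dualIdempotent G x ℝ l.1 = Matrix.diagonal (E e x) := by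
    rw [sum_smul_dualIdempotent hG.1]
    congr 1
    funext u
    exact hE.apply_eq hG e (hyz _)
  refine ⟨{ E := E
            Es := fun l => dualIdempotent G x ℝ l.1
            θ := θ
            θs := fun l => E e (y l) (z l)
            θ_injective := hE.injective
            θs_injective := ?_
            mul_E := hE.mul
            mul_Es := fun i j => by rw [dualIdempotent_mul]; simp only [Fin.ext_iff]
            sum_E := hE.sum
            sum_Es := ?_
            E_tridiag := ?_
            Es_tridiag := ?_ }, hE, fun l => rfl⟩
  · intro l l' h
    have := hE.dist_eq_of_one_apply_eq hG hq hqz (e := e) rfl h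
    rw [hyz, hyz] at this
    exact Fin.ext this
  · simpa using sum_smul_dualIdempotent hG.1 x fun _ => 1
  · intro i k h
    rw [hdual]
    exact hE.mul_diagonal_mul_eq_zero hq ((hqz e i k).1 (by simp only [e]; omega)) x
  · intro i k h
    rw [hE.sum_smul]
    exact dualIdempotent_mul_adjacency_mul hG.1 x h

end Construction

/-! ### Real idempotents, positivity and corners -/

/-- A normal idempotent is an orthogonal projection: `c - c cᵀ` has norm zero. This makes central
idempotents of `T` symmetric. -/
theorem transpose_eq_of_commute_of_mul_self {X : Type*} [Fintype X] {c : Matrix X X ℝ} (hc : c * c = c)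
    (h : Commute c c.transpose) : c.transpose = c := by
  have hct : c.transpose * c.transpose = c.transpose := by rw [← Matrix.transpose_mul, hc]
  have hz : c - c * c.transpose = 0 := by
    rw [← Matrix.conjTranspose_mul_self_eq_zero, Matrix.conjTranspose_eq_transpose_of_trivial,
      Matrix.transpose_sub, Matrix.transpose_mul, Matrix.transpose_transpose]
    have h1 : c.transpose * c = c * c.transpose := h.eq.symm
    have h2 : c.transpose * (c * c.transpose) = c * c.transpose := by
      rw [← mul_assoc, h1, mul_assoc, hct]
    have h3 : c * c.transpose * c = c * c.transpose := by rw [mul_assoc, h1, ← mul_assoc, hc]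
    have h4 : c * c.transpose * (c * c.transpose) = c * c.transpose := by
      rw [← mul_assoc, h3, mul_assoc, hct]
    rw [sub_mul, mul_sub, mul_sub, h1, h2, h3, h4]
    simp
  have hc' : c = c * c.transpose := sub_eq_zero.1 hz
  calc c.transpose = (c * c.transpose).transpose := by rw [← hc']
    _ = c * c.transpose := by rw [Matrix.transpose_mul, Matrix.transpose_transpose]
    _ = c := hc'.symm

theorem eq_zero_of_isSymm_of_mul_self_eq_neg {X : Type*} [Fintype X] {a b : Matrix X X ℝ} (ha : a.transpose = a)
    (hb : b.transpose = b) (hbb : b * b = b) (hab : a * a = -b) : b = 0 := by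
  rw [← Matrix.trace_conjTranspose_mul_self_eq_zero_iff,
    Matrix.conjTranspose_eq_transpose_of_trivial]
  have h1 := (Matrix.posSemidef_conjTranspose_mul_self a).trace_nonneg
  have h2 := (Matrix.posSemidef_conjTranspose_mul_self b).trace_nonneg
  rw [Matrix.conjTranspose_eq_transpose_of_trivial] at h1 h2
  rw [ha, hab, Matrix.trace_neg] at h1
  rw [hb, hbb] at h2 ⊢
  linarith

/-- A nonzero idempotent matrix over a division ring has a corner containing a copy of that
division ring. -/
theorem Matrix.exists_corner_embedding {R ι : Type*} [Ring R] [Fintype ι]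
    (hR : ∀ z : R, z ≠ 0 → ∃ w, w * z = 1) {ε : Matrix ι ι R} (hε : ε * ε = ε) (h0 : ε ≠ 0) :
    ∃ f : R → Matrix ι ι R, f 1 ≠ 0 ∧ (∀ d, ε * f d = f d) ∧ (∀ d, f d * ε = f d) ∧
      (∀ d, f (-d) = - f d) ∧ ∀ d d', f d * f d' = f (d * d') := by
  obtain ⟨a, b, hab⟩ : ∃ a b, ε a b ≠ 0 := by
    by_contra! h
    exact h0 (Matrix.ext h)
  obtain ⟨w, hw⟩ := hR _ hab
  have hentry : ∀ s t, ∑ u, ε s u * ε u t = ε s t := fun s t => by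
    rw [← Matrix.mul_apply, hε]
  -- Column `b` of `ε`, times `d * w`, times row `a`. Since row `a` times column `b` is `ε a b` and
  -- `w * ε a b = 1`, products of such matrices multiply the middle factors.
  refine ⟨fun d => Matrix.of fun s t => ε s b * (d * (w * ε a t)), ?_, ?_, ?_, ?_, ?_⟩
  · intro h
    have := congrFun (congrFun h a) b
    simp only [Matrix.of_apply, hw, mul_one, Matrix.zero_apply] at this
    exact hab this
  · intro d
    ext s t
    simp only [Matrix.mul_apply, Matrix.of_apply]
    simp_rw [← mul_assoc (ε s _)]
    rw [← Finset.sum_mul, hentry, mul_assoc]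
  · intro d
    ext s t
    simp only [Matrix.mul_apply, Matrix.of_apply, mul_assoc]
    simp only [← Finset.mul_sum, hentry]
  · intro d
    ext s t
    simp
  · intro d d'
    ext s t
    simp only [Matrix.mul_apply, Matrix.of_apply]
    calc ∑ u, ε s b * (d * (w * ε a u)) * (ε u b * (d' * (w * ε a t)))
        = ε s b * (d * (w * (∑ u, ε a u * ε u b))) * (d' * (w * ε a t)) := by
          simp only [Finset.mul_sum, Finset.sum_mul, mul_assoc]
      _ = _ := by rw [hentry, hw, mul_one]; simp only [mul_assoc]

/-! ### Coordinate division rings of the real Terwilliger algebra -/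

section RealTerwilliger

variable {X : Type*} [Fintype X] [DecidableEq X] {G : SimpleGraph X} {x : X}
  {Φ : TridiagonalIdempotents ℝ (Matrix X X ℝ) (G.diam + 1)}

theorem terwilligerAlgebra_eq_adjoin (hG : IsDistanceRegular G) (hdiam : 1 ≤ G.diam)
    (hE : IsSpectralResolution G Φ.E Φ.θ) (hEs : ∀ l, Φ.Es l = dualIdempotent G x ℝ l.1) :
    terwilligerAlgebra G x ℝ = Algebra.adjoin ℝ (Set.range Φ.E ∪ Set.range Φ.Es) := by
  refine le_antisymm (Algebra.adjoin_le ?_) (Algebra.adjoin_le ?_)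
  · rintro B (hB | hB)
    · have : boseMesner G ℝ ≤ Subalgebra.toSubmodule
          (Algebra.adjoin ℝ (Set.range Φ.E ∪ Set.range Φ.Es)) := by
        refine Submodule.span_le.2 ?_
        rintro _ ⟨l, hl, rfl⟩
        exact (Submodule.span_mono Set.subset_union_left).trans
          (Algebra.span_le_adjoin ℝ _) (hE.distMatrix_mem_span hG hl)
      exact this hB
    · have : dualBoseMesner G x ℝ ≤ Subalgebra.toSubmodule
          (Algebra.adjoin ℝ (Set.range Φ.E ∪ Set.range Φ.Es)) := by
        refine Submodule.span_le.2 ?_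
        rintro _ ⟨l, hl, rfl⟩
        exact Algebra.subset_adjoin (Or.inr ⟨⟨l, by omega⟩, hEs _⟩)
      exact this hB
  · rintro _ (⟨i, rfl⟩ | ⟨l, rfl⟩)
    · have hle : Algebra.adjoin ℝ {distMatrix G ℝ 1} ≤ terwilligerAlgebra G x ℝ :=
        Algebra.adjoin_mono (Set.singleton_subset_iff.2
          (Or.inl (Submodule.subset_span ⟨1, hdiam, rfl⟩)))
      exact hle (hE.mem_adjoin i)
    · exact Algebra.subset_adjoin
        (Or.inr (Submodule.subset_span ⟨l, Nat.lt_succ_iff.1 l.2, hEs l⟩))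

theorem transpose_mem_adjoin (hE : ∀ i, (Φ.E i).transpose = Φ.E i)
    (hEs : ∀ i, (Φ.Es i).transpose = Φ.Es i) {t : Matrix X X ℝ}
    (ht : t ∈ Algebra.adjoin ℝ (Set.range Φ.E ∪ Set.range Φ.Es)) :
    t.transpose ∈ Algebra.adjoin ℝ (Set.range Φ.E ∪ Set.range Φ.Es) := by
  induction ht using Algebra.adjoin_induction with
  | mem t ht =>
    rcases ht with ⟨i, rfl⟩ | ⟨i, rfl⟩
    · rw [hE]; exact Algebra.subset_adjoin (Or.inl ⟨i, rfl⟩)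
    · rw [hEs]; exact Algebra.subset_adjoin (Or.inr ⟨i, rfl⟩)
  | algebraMap a =>
    rw [Matrix.algebraMap_eq_diagonal, Matrix.diagonal_transpose, ← Matrix.algebraMap_eq_diagonal]
    exact Subalgebra.algebraMap_mem _ a
  | add a b _ _ ha hb => rw [Matrix.transpose_add]; exact add_mem ha hb
  | mul a b _ _ ha hb => rw [Matrix.transpose_mul]; exact mul_mem hb ha

/-- In the corner of `T` cut out by a central idempotent `c` and its endpoint `r`, every matrix is
symmetric. -/
theorem transpose_corner_eq (hG : IsDistanceRegular G) (hdiam : 1 ≤ G.diam)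
    (hE : IsSpectralResolution G Φ.E Φ.θ) (hEs : ∀ l, Φ.Es l = dualIdempotent G x ℝ l.1)
    {c : Matrix X X ℝ} (hcT : c ∈ terwilligerAlgebra G x ℝ) (hc : c * c = c)
    (hcomm : ∀ t ∈ terwilligerAlgebra G x ℝ, Commute c t) {r : Fin (G.diam + 1)}
    (hr : ∀ l, l.1 < r.1 → c * Φ.Es l = 0) {t : Matrix X X ℝ}
    (ht : t ∈ terwilligerAlgebra G x ℝ) :
    (c * Φ.Es r * t * Φ.Es r).transpose = c * Φ.Es r * t * Φ.Es r := by
  have hEst : ∀ i, (Φ.Es i).transpose = Φ.Es i := fun i => by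
    rw [hEs, dualIdempotent, Matrix.diagonal_transpose]
  rw [terwilligerAlgebra_eq_adjoin hG hdiam hE hEs] at hcT hcomm ht
  exact TridiagonalIdempotents.map_corner_eq (Φ := Φ)
    (σ := (Matrix.transposeLinearEquiv X X ℝ ℝ).toLinearMap)
    (fun a b => Matrix.transpose_mul a b) hE.transpose_eq hEst
    (transpose_eq_of_commute_of_mul_self hc (hcomm _ (transpose_mem_adjoin hE.transpose_eq hEst hcT)))
    hc (fun i => hcomm _ (Algebra.subset_adjoin (Or.inl ⟨i, rfl⟩)))
    (fun i => hcomm _ (Algebra.subset_adjoin (Or.inr ⟨i, rfl⟩))) hr ht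

/-- No coordinate division ring of the real Terwilliger algebra contains a square root of `-1`. -/
theorem mul_self_ne_neg_one_of_algEquiv (hG : IsDistanceRegular G) (hdiam : 1 ≤ G.diam)
    (hQ : IsQPolynomial G) {l : ℕ} {m : Fin l → ℕ} (hm : ∀ i, 0 < m i)
    {D : Fin l → Type*} [∀ i, Ring (D i)] [∀ i, Algebra ℝ (D i)]
    (e : terwilligerAlgebra G x ℝ ≃ₐ[ℝ] ((i : Fin l) → Matrix (Fin (m i)) (Fin (m i)) (D i)))
    (i : Fin l) [Nontrivial (D i)] (hdiv : ∀ z : D i, z ≠ 0 → ∃ w, w * z = 1) (d : D i) :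
    d * d ≠ -1 := by
  intro hd
  obtain ⟨Φ, hE, hEs⟩ := exists_tridiagonalIdempotents hG hdiam hQ x
  have : Nonempty (Fin (m i)) := ⟨⟨0, hm i⟩⟩
  let T := terwilligerAlgebra G x ℝ
  have hEsT : ∀ r, Φ.Es r ∈ T := fun r => Algebra.subset_adjoin
    (Or.inr (Submodule.subset_span ⟨r, Nat.lt_succ_iff.1 r.2, hEs r⟩))
  let u : (i : Fin l) → Matrix (Fin (m i)) (Fin (m i)) (D i) := Pi.single i 1
  have hu : ∀ b, u * b = Pi.single i (b i) := fun b => by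
    rw [← Pi.single_mul_left, one_mul]
  have hu' : ∀ b, b * u = Pi.single i (b i) := fun b => by
    rw [← Pi.single_mul_right, mul_one]
  let c : T := e.symm u
  have hec : e c = u := e.apply_symm_apply u
  have hcc : c * c = c := e.injective (by rw [map_mul, hec, hu]; simp [u])
  have hc0 : c ≠ 0 := by
    intro h
    have h1 : u = 0 := by rw [← hec, h, map_zero]
    have h2 := congrFun h1 i
    simp [u] at h2
  have hcomm : ∀ t : T, c * t = t * c := fun t =>
    e.injective (by rw [map_mul, map_mul, hec, hu, hu'])
  let es : Fin (G.diam + 1) → T := fun r => ⟨Φ.Es r, hEsT r⟩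
  -- The endpoint of the block; it exists because the dual idempotents sum to `1` and `c ≠ 0`.
  obtain ⟨r, hr0, hrmin⟩ : ∃ r, c * es r ≠ 0 ∧ ∀ l, l < r → c * es l = 0 := by
    have hne : {r | c * es r ≠ 0}.Nonempty := by
      by_contra h
      have h' : ∀ r, c * es r = 0 := by
        intro r
        by_contra hr
        exact h ⟨r, hr⟩
      apply hc0
      have h1 : ∑ r, es r = 1 := Subtype.ext (by simpa [es] using Φ.sum_Es)
      rw [← mul_one c, ← h1, Finset.mul_sum]
      exact Finset.sum_eq_zero fun r _ => h' r
    obtain ⟨r, hr, hmin⟩ := WellFounded.has_min (wellFounded_lt (α := Fin (G.diam + 1))) _ hne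
    refine ⟨r, hr, fun l hl => ?_⟩
    by_contra h
    exact hmin l h hl
  have hes : es r * es r = es r := Subtype.ext (by
    change Φ.Es r * Φ.Es r = Φ.Es r
    rw [Φ.mul_Es, if_pos rfl])
  let ε : Matrix (Fin (m i)) (Fin (m i)) (D i) := e (c * es r) i
  have hee : e (c * es r) = Pi.single i ε := by
    rw [map_mul, hec, hu]
    simp [ε, hec, u]
  have hε0 : ε ≠ 0 := by
    intro h
    rw [h, Pi.single_zero] at hee
    exact hr0 ((map_eq_zero_iff e e.injective).1 hee)
  have hidem : c * es r * (c * es r) = c * es r := by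
    rw [← mul_assoc, mul_assoc c, ← hcomm, ← mul_assoc, hcc, mul_assoc, hes]
  have hεε : ε * ε = ε := by
    have := congrArg (fun t => e t i) hidem
    simpa only [map_mul, Pi.mul_apply, ε] using this
  obtain ⟨f, hf1, hfl, hfr, hfneg, hfmul⟩ := Matrix.exists_corner_embedding hdiv hεε hε0
  -- A multiplicative copy of `D i` in the symmetric corner, with unit `y 1`; then `y d * y d = -y
  -- 1` contradicts positivity.
  let y : D i → T := fun z => e.symm (Pi.single i (f z))
  have hey : ∀ z, e (y z) = Pi.single i (f z) := fun z => e.apply_symm_apply _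
  have hymul : ∀ z z', y z * y z' = y (z * z') := fun z z' => e.injective (by
    rw [map_mul, hey, hey, hey, ← Pi.single_mul, hfmul])
  have hyl : ∀ z, c * es r * y z = y z := fun z => e.injective (by
    rw [map_mul, hey, hee, ← Pi.single_mul, hfl])
  have hyr : ∀ z, y z * es r = y z := by
    intro z
    have h1 : y z * (c * es r) = y z := e.injective (by
      rw [map_mul, hey, hee, ← Pi.single_mul, hfr])
    have h2 : y z * c = y z := e.injective (by
      rw [map_mul, hey, hec, hu']; simp)
    rw [← mul_assoc, h2] at h1
    exact h1
  have hsymm : ∀ z, (y z : Matrix X X ℝ).transpose = y z := by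
    intro z
    have h1 := transpose_corner_eq hG hdiam hE hEs c.2 (congrArg Subtype.val hcc)
      (fun t ht => congrArg Subtype.val (hcomm ⟨t, ht⟩)) (r := r)
      (fun l hl => congrArg Subtype.val (hrmin l hl)) (y z).2
    have h2 : (c : Matrix X X ℝ) * Φ.Es r * y z * Φ.Es r = y z :=
      congrArg Subtype.val ((congrArg (· * es r) (hyl z)).trans (hyr z))
    rwa [h2] at h1
  have hyneg : y (-1) = - y 1 := e.injective (by rw [map_neg, hey, hey, hfneg, Pi.single_neg])
  have hy0 := eq_zero_of_isSymm_of_mul_self_eq_neg (hsymm d) (hsymm 1)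
    (congrArg Subtype.val ((hymul 1 1).trans (by rw [one_mul])))
    (congrArg Subtype.val ((hymul d d).trans (by rw [hd, hyneg])))
  apply hf1
  have h1 : e (y 1) = 0 := by
    rw [show y 1 = 0 from Subtype.ext hy0, map_zero]
  rw [hey] at h1
  simpa using congrFun h1 i

/-- The coordinate division rings of the real Terwilliger algebra are all `ℝ`. -/
theorem nonempty_algEquiv_real (hG : IsDistanceRegular G) (hdiam : 1 ≤ G.diam)
    (hQ : IsQPolynomial G) {l : ℕ} {m : Fin l → ℕ} (hm : ∀ i, 0 < m i)
    {D : Fin l → Type*} [∀ i, Ring (D i)] [∀ i, Algebra ℝ (D i)]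
    (hD : ∀ i, Nonempty (D i ≃ₐ[ℝ] ℝ) ∨ Nonempty (D i ≃ₐ[ℝ] ℂ) ∨
      Nonempty (D i ≃ₐ[ℝ] Quaternion ℝ))
    (e : terwilligerAlgebra G x ℝ ≃ₐ[ℝ] ((i : Fin l) → Matrix (Fin (m i)) (Fin (m i)) (D i)))
    (i : Fin l) : Nonempty (D i ≃ₐ[ℝ] ℝ) := by
  have transfer : ∀ (K : Type) [DivisionRing K] [Algebra ℝ K] (_ : D i ≃ₐ[ℝ] K) (d : K),
      d * d ≠ -1 := by
    intro K _ _ g d hd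
    have : Nontrivial (D i) := g.toEquiv.nontrivial
    refine mul_self_ne_neg_one_of_algEquiv hG hdiam hQ hm e i ?_ (g.symm d) ?_
    · intro z hz
      refine ⟨g.symm (g z)⁻¹, g.injective ?_⟩
      rw [map_mul, g.apply_symm_apply, inv_mul_cancel₀, map_one]
      exact (map_ne_zero_iff g g.injective).2 hz
    · rw [← map_mul, hd, map_neg, map_one]
  rcases hD i with h | ⟨⟨g⟩⟩ | ⟨⟨g⟩⟩
  · exact h
  · exact absurd Complex.I_mul_I (transfer ℂ g Complex.I)
  · refine absurd ?_ (transfer (Quaternion ℝ) g (Quaternion.ofComplex Complex.I))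
    rw [← map_mul, Complex.I_mul_I, map_neg, map_one]

end RealTerwilliger

/-! ### Uniqueness of block sizes -/

section Wedderburn

variable {K ι κ : Type*} [Field K] [DecidableEq ι] [DecidableEq κ]
  {n : ι → ℕ} {m : κ → ℕ}

/-- Block identities are primitive among central idempotents: each component of `z` is a scalar `a`
with `a * a = a`. -/
theorem Pi.matrix_mul_single_one_eq_of_central (z : (i : ι) → Matrix (Fin (n i)) (Fin (n i)) K)
    (hz : z * z = z) (hcomm : ∀ b, Commute z b) (i : ι) (h : z * Pi.single i 1 ≠ 0) :
    z * Pi.single i 1 = Pi.single i 1 := by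
  have hsingle : z * Pi.single i 1 = Pi.single i (z i) := by
    rw [← Pi.single_mul_right, mul_one]
  have hci : z i ∈ Set.range (Matrix.scalar (Fin (n i))) := by
    refine Matrix.mem_range_scalar_of_commute_single fun a b _ => ?_
    have := congrFun (hcomm (Pi.single i (Matrix.single a b 1))).eq i
    simpa [Commute, SemiconjBy] using this.symm
  obtain ⟨a, ha⟩ := hci
  have haa : z i * z i = z i := congrFun hz i
  rw [hsingle] at h ⊢
  have hne : z i ≠ 0 := fun h0 => h (by rw [h0, Pi.single_zero])
  rw [← ha] at hne haa ⊢
  have ha0 : a ≠ 0 := by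
    rintro rfl
    exact hne (map_zero _)
  have hN : Nonempty (Fin (n i)) := by
    by_contra hN
    rw [not_nonempty_iff] at hN
    exact hne (Subsingleton.elim _ _)
  rw [← map_mul, Matrix.scalar_inj] at haa
  rw [mul_left_cancel₀ ha0 (haa.trans (mul_one a).symm), map_one]

theorem commute_pi_single_one (i : ι) (b : (i : ι) → Matrix (Fin (n i)) (Fin (n i)) K) :
    Commute (Pi.single i 1) b := by
  rw [Commute, SemiconjBy, ← Pi.single_mul_left, ← Pi.single_mul_right, one_mul, mul_one]

/-- The images of the block identities sum to `1`, so one of them meets block `j`; primitivity on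
both sides makes the two idempotents equal. -/
theorem exists_map_pi_single_one_eq [Fintype ι]
    (e : ((i : ι) → Matrix (Fin (n i)) (Fin (n i)) K) ≃ₐ[K]
      ((j : κ) → Matrix (Fin (m j)) (Fin (m j)) K))
    (hm : ∀ j, 0 < m j) (j : κ) :
    ∃ i, e (Pi.single i 1) = Pi.single j 1 := by
  have hj : Nonempty (Fin (m j)) := ⟨⟨0, hm j⟩⟩
  have hne : (Pi.single j 1 : (j : κ) → Matrix (Fin (m j)) (Fin (m j)) K) ≠ 0 := by
    rw [Ne, Pi.single_eq_zero_iff]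
    exact one_ne_zero
  obtain ⟨i, hi⟩ : ∃ i, e (Pi.single i 1) * Pi.single j 1 ≠ 0 := by
    by_contra! h
    apply hne
    have h1 : ∑ i, (Pi.single i 1 : (i : ι) → Matrix (Fin (n i)) (Fin (n i)) K) = 1 :=
      Finset.univ_sum_single (1 : (i : ι) → Matrix (Fin (n i)) (Fin (n i)) K)
    rw [← one_mul (Pi.single j 1), ← map_one e, ← h1, map_sum, Finset.sum_mul]
    exact Finset.sum_eq_zero fun i _ => h i
  refine ⟨i, ?_⟩
  have h1 := Pi.matrix_mul_single_one_eq_of_central (e (Pi.single i 1))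
    (by rw [← map_mul, ← Pi.single_mul, one_mul])
    (fun b => by
      have := (commute_pi_single_one (K := K) (n := n) i (e.symm b)).map e
      rwa [e.apply_symm_apply] at this) j hi
  have h2 := Pi.matrix_mul_single_one_eq_of_central (e.symm (Pi.single j 1))
    (by rw [← map_mul, ← Pi.single_mul, one_mul])
    (fun b => by
      have := (commute_pi_single_one (K := K) (n := m) j (e b)).map e.symm
      rwa [e.symm_apply_apply] at this) i (by
        intro h
        apply hi
        have := congrArg e h
        rw [map_mul, e.apply_symm_apply, map_zero] at this
        rw [(commute_pi_single_one j _).eq] at this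
        exact this)
  have h3 := congrArg e h2
  rw [map_mul, e.apply_symm_apply, (commute_pi_single_one j _).eq, h1] at h3
  exact h3.symm

/-- The isomorphism embeds one block into the other; compare the dimensions `n²` and `m²`. -/
theorem le_of_map_pi_single_one_eq
    (e : ((i : ι) → Matrix (Fin (n i)) (Fin (n i)) K) ≃ₐ[K]
      ((j : κ) → Matrix (Fin (m j)) (Fin (m j)) K))
    {i : ι} {j : κ} (h : e (Pi.single i 1) = Pi.single j 1) :
    n i ≤ m j := by
  let f : Matrix (Fin (n i)) (Fin (n i)) K →ₗ[K] Matrix (Fin (m j)) (Fin (m j)) K :=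
    (LinearMap.proj j).comp (e.toLinearMap.comp (LinearMap.single K _ i))
  have hf : Function.Injective f := by
    rw [← LinearMap.ker_eq_bot, LinearMap.ker_eq_bot']
    intro M hM
    have h1 : e (Pi.single i M) = Pi.single j (e (Pi.single i M) j) := by
      conv_lhs => rw [← one_mul M, Pi.single_mul, map_mul, h, ← Pi.single_mul_left, one_mul]
    have h2 : e (Pi.single i M) j = 0 := hM
    rw [h2, Pi.single_zero, map_eq_zero_iff e e.injective, Pi.single_eq_zero_iff] at h1
    exact h1
  have := LinearMap.finrank_le_finrank_of_injective hf
  simp only [Module.finrank_matrix, Fintype.card_fin, Module.finrank_self, mul_one] at this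
  exact Nat.mul_self_le_mul_self_iff.1 this

/-- Uniqueness of the matrix sizes in the decomposition of a split semisimple algebra. -/
theorem exists_equiv_of_pi_matrix_algEquiv [Fintype ι] [Fintype κ]
    (e : ((i : ι) → Matrix (Fin (n i)) (Fin (n i)) K) ≃ₐ[K]
      ((j : κ) → Matrix (Fin (m j)) (Fin (m j)) K))
    (hn : ∀ i, 0 < n i) (hm : ∀ j, 0 < m j) :
    ∃ σ : κ ≃ ι, ∀ j, m j = n (σ j) := by
  choose σ hσ using exists_map_pi_single_one_eq e hm
  have hinj : ∀ {j j' : κ}, (Pi.single j 1 : (j : κ) → Matrix (Fin (m j)) (Fin (m j)) K) =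
      Pi.single j' 1 → j = j' := by
    intro j j' h
    by_contra hne
    have hj : Nonempty (Fin (m j)) := ⟨⟨0, hm j⟩⟩
    have := congrFun h j
    rw [Pi.single_eq_same, Pi.single_eq_of_ne hne] at this
    exact one_ne_zero this
  have hbij : Function.Bijective σ := by
    constructor
    · intro j j' h
      exact hinj (by rw [← hσ, ← hσ, h])
    · intro i
      obtain ⟨j, hj⟩ := exists_map_pi_single_one_eq e.symm hn i
      refine ⟨j, ?_⟩
      rw [← hσ, e.symm_apply_apply] at hj
      by_contra hne
      have hi : Nonempty (Fin (n i)) := ⟨⟨0, hn i⟩⟩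
      have := congrFun hj i
      rw [Pi.single_eq_same, Pi.single_eq_of_ne (Ne.symm hne)] at this
      exact zero_ne_one this
  refine ⟨Equiv.ofBijective σ hbij, fun j => le_antisymm ?_ ?_⟩
  · refine le_of_map_pi_single_one_eq e.symm ?_
    rw [Equiv.ofBijective_apply, ← hσ, e.symm_apply_apply]
  · exact le_of_map_pi_single_one_eq e (hσ j)

end Wedderburn

/-! ### Real forms of complex algebras -/

section Complexification

/-- The real algebra `T` is, via `ι`, a real form of the complex algebra `A`. -/
def IsRealForm {T A : Type*} [Ring T] [Algebra ℝ T] [Ring A] [Algebra ℂ A] [Algebra ℝ A]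
    (ι : T →ₐ[ℝ] A) : Prop :=
  Function.Bijective fun p : T × T => ι p.1 + Complex.I • ι p.2

theorem IsRealForm.mul_eq {T A : Type*} [Ring T] [Algebra ℝ T] [Ring A] [Algebra ℂ A] [Algebra ℝ A]
    (ι : T →ₐ[ℝ] A) (s t s' t' : T) :
    (ι s + Complex.I • ι t) * (ι s' + Complex.I • ι t') =
      ι (s * s' - t * t') + Complex.I • ι (s * t' + t * s') := by
  simp only [add_mul, mul_add, smul_mul_assoc, mul_smul_comm, map_sub, map_add, map_mul,
    smul_add, smul_smul, Complex.I_mul_I]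
  rw [neg_one_smul]
  abel

theorem IsRealForm.add_eq {T A : Type*} [Ring T] [Algebra ℝ T] [Ring A] [Algebra ℂ A] [Algebra ℝ A]
    (ι : T →ₐ[ℝ] A) (s t s' t' : T) :
    (ι s + Complex.I • ι t) + (ι s' + Complex.I • ι t') =
      ι (s + s') + Complex.I • ι (t + t') := by
  simp only [map_add, smul_add]
  abel

theorem IsRealForm.algebraMap_eq {T A : Type*} [Ring T] [Algebra ℝ T] [Ring A] [Algebra ℂ A]
    [Algebra ℝ A] [IsScalarTower ℝ ℂ A] (ι : T →ₐ[ℝ] A) (z : ℂ) :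
    algebraMap ℂ A z = ι (algebraMap ℝ T z.re) + Complex.I • ι (algebraMap ℝ T z.im) := by
  rw [AlgHom.commutes, AlgHom.commutes, IsScalarTower.algebraMap_apply ℝ ℂ A,
    IsScalarTower.algebraMap_apply ℝ ℂ A, Algebra.smul_def, ← map_mul, ← map_add]
  congr 1
  rw [mul_comm]
  exact (Complex.re_add_im z).symm

/-- In the coordinates `(s, t)` the sum, product and complex scalars are expressed through the real
algebra alone, so `ψ` applied coordinatewise respects them. -/
theorem IsRealForm.nonempty_algEquiv {T A T' A' : Type*} [Ring T] [Algebra ℝ T] [Ring A]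
    [Algebra ℂ A] [Algebra ℝ A] [IsScalarTower ℝ ℂ A] [Ring T'] [Algebra ℝ T'] [Ring A']
    [Algebra ℂ A'] [Algebra ℝ A'] [IsScalarTower ℝ ℂ A'] {ι : T →ₐ[ℝ] A} {ι' : T' →ₐ[ℝ] A'}
    (h : IsRealForm ι) (h' : IsRealForm ι') (ψ : T ≃ₐ[ℝ] T') : Nonempty (A ≃ₐ[ℂ] A') := by
  let F := Equiv.ofBijective _ h
  let F' := Equiv.ofBijective _ h'
  let e : A ≃ A' := (F.symm.trans (ψ.toEquiv.prodCongr ψ.toEquiv)).trans F'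
  have he : ∀ s t, e (ι s + Complex.I • ι t) = ι' (ψ s) + Complex.I • ι' (ψ t) := by
    intro s t
    have : ι s + Complex.I • ι t = F (s, t) := rfl
    simp only [e, this, Equiv.trans_apply, Equiv.symm_apply_apply]
    rfl
  refine ⟨AlgEquiv.mk e ?_ ?_ ?_⟩
  · intro a b
    obtain ⟨⟨s, t⟩, rfl⟩ := h.2 a
    obtain ⟨⟨s', t'⟩, rfl⟩ := h.2 b
    change e _ = e _ * e _
    simp only [IsRealForm.mul_eq, he]
    simp only [map_sub, map_add, map_mul]
  · intro a b
    obtain ⟨⟨s, t⟩, rfl⟩ := h.2 a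
    obtain ⟨⟨s', t'⟩, rfl⟩ := h.2 b
    change e _ = e _ + e _
    simp only [IsRealForm.add_eq, he]
    simp only [map_add]
  · intro z
    change e _ = _
    rw [IsRealForm.algebraMap_eq ι, he, AlgEquiv.commutes, AlgEquiv.commutes,
      ← IsRealForm.algebraMap_eq ι']

theorem Matrix.ofReal_add_I_smul_injective {X : Type*} {M N M' N' : Matrix X X ℝ}
    (h : M.map (fun r : ℝ => (r : ℂ)) + Complex.I • N.map (fun r : ℝ => (r : ℂ)) =
      M'.map (fun r : ℝ => (r : ℂ)) + Complex.I • N'.map (fun r : ℝ => (r : ℂ))) :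
    M = M' ∧ N = N' := by
  constructor
  · ext y z
    simpa using congrArg Complex.re (congrFun (congrFun h y) z)
  · ext y z
    simpa using congrArg Complex.im (congrFun (congrFun h y) z)

theorem Matrix.map_re_add_I_smul_map_im {X : Type*} (P : Matrix X X ℂ) :
    (P.map Complex.re).map (fun r : ℝ => (r : ℂ)) +
      Complex.I • (P.map Complex.im).map (fun r : ℝ => (r : ℂ)) = P := by
  ext y z
  simp only [Matrix.add_apply, Matrix.smul_apply, Matrix.map_apply, smul_eq_mul]
  rw [mul_comm]
  exact Complex.re_add_im _

/-- Products of real matrix algebras are real forms of products of complex matrix algebras. -/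
theorem isRealForm_pi_matrix {l : ℕ} (m : Fin l → ℕ) :
    IsRealForm (T := (i : Fin l) → Matrix (Fin (m i)) (Fin (m i)) ℝ)
      (A := (i : Fin l) → Matrix (Fin (m i)) (Fin (m i)) ℂ)
      (AlgHom.pi fun i => Complex.ofRealAm.mapMatrix.comp (Pi.evalAlgHom ℝ _ i)) := by
  constructor
  · rintro ⟨s, t⟩ ⟨s', t'⟩ h
    have := fun i => Matrix.ofReal_add_I_smul_injective (congrFun h i)
    exact Prod.ext (funext fun i => (this i).1) (funext fun i => (this i).2)
  · intro P
    exact ⟨(fun i => (P i).map Complex.re, fun i => (P i).map Complex.im),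
      funext fun i => Matrix.map_re_add_I_smul_map_im (P i)⟩

end Complexification

/-! ### The complex Terwilliger algebra as a complexification -/

section ComplexTerwilliger

variable {X : Type*} [Fintype X] [DecidableEq X] (G : SimpleGraph X) (x : X)

theorem map_ofReal_mem_terwilligerAlgebra {M : Matrix X X ℝ} (hM : M ∈ terwilligerAlgebra G x ℝ) :
    Complex.ofRealAm.mapMatrix M ∈ terwilligerAlgebra G x ℂ := by
  let S : Subalgebra ℝ (Matrix X X ℝ) :=
    ((terwilligerAlgebra G x ℂ).restrictScalars ℝ).comap Complex.ofRealAm.mapMatrix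
  have hle : terwilligerAlgebra G x ℝ ≤ S := by
    refine Algebra.adjoin_le (Set.union_subset ?_ ?_)
    · change boseMesner G ℝ ≤ Subalgebra.toSubmodule S
      refine Submodule.span_le.2 ?_
      rintro _ ⟨i, hi, rfl⟩
      have : Complex.ofRealAm.mapMatrix (distMatrix G ℝ i) = distMatrix G ℂ i := by
        ext y z
        simp [distMatrix, apply_ite]
      change Complex.ofRealAm.mapMatrix (distMatrix G ℝ i) ∈ terwilligerAlgebra G x ℂ
      rw [this]
      exact Algebra.subset_adjoin (Or.inl (Submodule.subset_span ⟨i, hi, rfl⟩))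
    · change dualBoseMesner G x ℝ ≤ Subalgebra.toSubmodule S
      refine Submodule.span_le.2 ?_
      rintro _ ⟨i, hi, rfl⟩
      have : Complex.ofRealAm.mapMatrix (dualIdempotent G x ℝ i) = dualIdempotent G x ℂ i := by
        ext y z
        simp [dualIdempotent, Matrix.diagonal_apply, apply_ite Complex.ofReal]
      change Complex.ofRealAm.mapMatrix (dualIdempotent G x ℝ i) ∈ terwilligerAlgebra G x ℂ
      rw [this]
      exact Algebra.subset_adjoin (Or.inr (Submodule.subset_span ⟨i, hi, rfl⟩))
  exact hle hM

theorem re_im_mem_terwilligerAlgebra {P : Matrix X X ℂ} (hP : P ∈ terwilligerAlgebra G x ℂ) :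
    P.map Complex.re ∈ terwilligerAlgebra G x ℝ ∧ P.map Complex.im ∈ terwilligerAlgebra G x ℝ := by
  have hmul : ∀ P Q : Matrix X X ℂ,
      (P * Q).map Complex.re = P.map Complex.re * Q.map Complex.re -
        P.map Complex.im * Q.map Complex.im ∧
      (P * Q).map Complex.im = P.map Complex.re * Q.map Complex.im +
        P.map Complex.im * Q.map Complex.re := by
    intro P Q
    constructor <;> ext y z <;>
      simp [Matrix.mul_apply, Finset.sum_sub_distrib, Finset.sum_add_distrib]
  have hmap : ∀ z : ℂ, (algebraMap ℂ (Matrix X X ℂ) z).map Complex.re =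
      algebraMap ℝ (Matrix X X ℝ) z.re ∧ (algebraMap ℂ (Matrix X X ℂ) z).map Complex.im =
      algebraMap ℝ (Matrix X X ℝ) z.im := by
    intro z
    constructor <;> ext y w <;>
      simp [Matrix.algebraMap_matrix_apply, apply_ite Complex.re, apply_ite Complex.im]
  -- Matrices with real and imaginary parts in `T^ℝ` form a complex subalgebra, which contains the
  -- generators because these have real entries.
  let S : Subalgebra ℂ (Matrix X X ℂ) :=
    { carrier := {P | P.map Complex.re ∈ terwilligerAlgebra G x ℝ ∧
        P.map Complex.im ∈ terwilligerAlgebra G x ℝ}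
      mul_mem' := fun {P Q} hP hQ => by
        change _ ∧ _
        rw [(hmul P Q).1, (hmul P Q).2]
        exact ⟨sub_mem (mul_mem hP.1 hQ.1) (mul_mem hP.2 hQ.2),
          add_mem (mul_mem hP.1 hQ.2) (mul_mem hP.2 hQ.1)⟩
      add_mem' := fun {P Q} hP hQ => by
        change _ ∧ _
        rw [Matrix.map_add _ Complex.add_re, Matrix.map_add _ Complex.add_im]
        exact ⟨add_mem hP.1 hQ.1, add_mem hP.2 hQ.2⟩
      algebraMap_mem' := fun z => by
        change _ ∧ _
        rw [(hmap z).1, (hmap z).2]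
        exact ⟨Subalgebra.algebraMap_mem _ _, Subalgebra.algebraMap_mem _ _⟩ }
  have hle : terwilligerAlgebra G x ℂ ≤ S := by
    refine Algebra.adjoin_le (Set.union_subset ?_ ?_)
    · change boseMesner G ℂ ≤ Subalgebra.toSubmodule S
      refine Submodule.span_le.2 ?_
      rintro _ ⟨i, hi, rfl⟩
      have h1 : (distMatrix G ℂ i).map Complex.re = distMatrix G ℝ i := by
        ext y z
        simp [distMatrix, apply_ite Complex.re]
      have h2 : (distMatrix G ℂ i).map Complex.im = 0 := by
        ext y z
        simp [distMatrix, apply_ite Complex.im]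
      change _ ∧ _
      rw [h1, h2]
      exact ⟨Algebra.subset_adjoin (Or.inl (Submodule.subset_span ⟨i, hi, rfl⟩)), zero_mem _⟩
    · change dualBoseMesner G x ℂ ≤ Subalgebra.toSubmodule S
      refine Submodule.span_le.2 ?_
      rintro _ ⟨i, hi, rfl⟩
      have h1 : (dualIdempotent G x ℂ i).map Complex.re = dualIdempotent G x ℝ i := by
        ext y z
        simp [dualIdempotent, Matrix.diagonal_apply, apply_ite Complex.re]
      have h2 : (dualIdempotent G x ℂ i).map Complex.im = 0 := by
        ext y z
        simp [dualIdempotent, Matrix.diagonal_apply, apply_ite Complex.im]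
      change _ ∧ _
      rw [h1, h2]
      exact ⟨Algebra.subset_adjoin (Or.inr (Submodule.subset_span ⟨i, hi, rfl⟩)), zero_mem _⟩
  exact hle hP

/-- The inclusion of the real into the complex Terwilliger algebra. -/
noncomputable def terwilligerAlgebraOfReal :
    terwilligerAlgebra G x ℝ →ₐ[ℝ] terwilligerAlgebra G x ℂ :=
  AlgHom.codRestrict (S := (terwilligerAlgebra G x ℂ).restrictScalars ℝ)
    (Complex.ofRealAm.mapMatrix.comp (terwilligerAlgebra G x ℝ).val)
    fun t => map_ofReal_mem_terwilligerAlgebra G x t.2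

theorem isRealForm_terwilligerAlgebra : IsRealForm (terwilligerAlgebraOfReal G x) := by
  constructor
  · rintro ⟨s, t⟩ ⟨s', t'⟩ h
    have := Matrix.ofReal_add_I_smul_injective (congrArg Subtype.val h)
    exact Prod.ext (Subtype.ext this.1) (Subtype.ext this.2)
  · intro P
    have h := re_im_mem_terwilligerAlgebra G x P.2
    exact ⟨(⟨_, h.1⟩, ⟨_, h.2⟩), Subtype.ext (Matrix.map_re_add_I_smul_map_im P.1)⟩

end ComplexTerwilliger

/-- Let `G` be a `Q`-polynomial distance-regular graph of diameter at least `3`, and let `x` be a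
vertex. For any Wedderburn decompositions `T^ℂ ≅ ⊕ Mat_{n_i}(ℂ)` and `T^ℝ ≅ ⊕ Mat_{m_i}(D_i)`
of the Terwilliger algebras, with each `D_i` one of `ℝ`, `ℂ`, `ℍ`, the numbers of summands agree,
the sizes agree up to the order of the summands, and every `D_i` is `ℝ`. -/
theorem theorem1p5 {X : Type*} [Fintype X] [DecidableEq X] (G : SimpleGraph X)
    (hG : IsDistanceRegular G) (hdiam : 3 ≤ G.diam) (hQ : IsQPolynomial G) (x : X)
    (h : ℕ) (n : Fin h → ℕ) (hn : ∀ i, 0 < n i)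
    (eC : terwilligerAlgebra G x ℂ ≃ₐ[ℂ] ((i : Fin h) → Matrix (Fin (n i)) (Fin (n i)) ℂ))
    (l : ℕ) (m : Fin l → ℕ) (hm : ∀ i, 0 < m i)
    (D : Fin l → Type*) [∀ i, Ring (D i)] [∀ i, Algebra ℝ (D i)]
    (hD : ∀ i, Nonempty (D i ≃ₐ[ℝ] ℝ) ∨ Nonempty (D i ≃ₐ[ℝ] ℂ) ∨
      Nonempty (D i ≃ₐ[ℝ] Quaternion ℝ))
    (eR : terwilligerAlgebra G x ℝ ≃ₐ[ℝ] ((i : Fin l) → Matrix (Fin (m i)) (Fin (m i)) (D i))) :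
    l = h ∧
      (∃ σ : Fin l ≃ Fin h, ∀ i, m i = n (σ i)) ∧
      ∀ i, Nonempty (D i ≃ₐ[ℝ] ℝ) := by
  have hreal := nonempty_algEquiv_real hG (by omega) hQ hm hD eR
  have ψ : terwilligerAlgebra G x ℝ ≃ₐ[ℝ] ((i : Fin l) → Matrix (Fin (m i)) (Fin (m i)) ℝ) :=
    eR.trans (AlgEquiv.piCongrRight fun i => (hreal i).some.mapMatrix)
  obtain ⟨f⟩ := (isRealForm_terwilligerAlgebra G x).nonempty_algEquiv (isRealForm_pi_matrix m) ψ
  obtain ⟨σ, hσ⟩ := exists_equiv_of_pi_matrix_algEquiv (eC.symm.trans f) hn hm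
  exact ⟨by simpa using Fintype.card_congr σ, ⟨σ, hσ⟩, hreal⟩
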